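/- \textbf{Setting.} Let $R_1,R_2,\dots$ be independent copies of a non-negative random variable $R$ with $\mathbb{E}R^2=1$. For every $d\in\mathbb{N}$ let $U_1^{(d)},U_2^{(d)},\dots$ be i.i.d.\ random vectors uniformly distributed on the unit sphere of $\mathbb{R}^d$, such that the sequences $(R_i)_{i\ge1}$ and $(U_i^{(d)})_{i\ge1}$ are independent. Put $$S_m^{(d)}=\sum_{i=1}^m R_iU_i^{(d)},\qquad m\in\mathbb{N}_0,$$ and let $\|\cdot\|$ be the Euclidean norm. Let $n=n(d)$ be a sequence of positive integers with $n(d)\to\infty$ as $d\to\infty$. Let $\overset{w}{\longrightarrow}$ denote convergence in distribution and $\mathrm{N}(0,1)$ the standard normal law. \textbf{Theorem.} Let $\alpha\in(1,2)$, let $L$ be a function that is slowly varying at infinity (measurable, eventually positive, $L(cx)/L(x)\to1$ as $x\to\infty$ for every $c>0$), and let $\zeta_\alpha$ be a zero-mean random variable with a spectrally positive $\alpha$-stable distribution, i.e.\ for some $\sigma>0$, $$\mathbb{E}\,e^{it\zeta_\alpha}=\exp\Big(-\sigma^\alpha|t|^\alpha\big(1-i\,\mathrm{sgn}(t)\tan\tfrac{\pi\alpha}{2}\big)\Big),\qquad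 t\in\mathbb{R}.$$ Suppose that $R^2$ is in the domain of attraction of $\zeta_\alpha$ in the sense that $$\frac{R_1^2+\dots+R_m^2-m}{m^{1/\alpha}L(m)}\overset{w}{\longrightarrow}\zeta_\alpha\qquad(m\to\infty).$$ (a) If there is $\delta>0$ such that $n(d)>d^{\frac{\alpha}{2\alpha-2}+\delta}$ for all sufficiently large $d$, then $$\frac{\|S_n^{(d)}\|^2-n}{\sqrt{2n^2/d}}\overset{w}{\longrightarrow}\mathrm{N}(0,1)\qquad(d\to\infty).$$ (b) If there is $\delta>0$ such that $n(d)<d^{\frac{\alpha}{2\alpha-2}-\delta}$ for all sufficiently large $d$, then $$\frac{\|S_n^{(d)}\|^2-n}{n^{1/\alpha}L(n)}\overset{w}{\longrightarrow}\zeta_\alpha\qquad(d\to\infty).$$ -/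

import Mathlib

open MeasureTheory ProbabilityTheory Filter Topology

/-- The uniform distribution on the unit sphere of `ℝ^d` (`d ≥ 1`), as a measure on `ℝ^d`:
the surface measure of the sphere, normalized to total mass one. -/
noncomputable def uniformUnitSphere (d : ℕ) : Measure (EuclideanSpace ℝ (Fin d)) :=
  (((volume : Measure (EuclideanSpace ℝ (Fin d))).toSphere Set.univ)⁻¹ •
    (volume : Measure (EuclideanSpace ℝ (Fin d))).toSphere).map Subtype.val

/-- `L` is slowly varying at infinity: measurable, eventually positive, and
`L (c x) / L x → 1` as `x → ∞`, for every `c > 0`. -/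
structure IsSlowlyVarying (L : ℝ → ℝ) : Prop where
  measurable : Measurable L
  eventually_pos : ∀ᶠ x in atTop, 0 < L x
  tendsto_ratio : ∀ c : ℝ, 0 < c → Tendsto (fun x : ℝ => L (c * x) / L x) atTop (𝓝 1)

/-- `ν` is the (nondegenerate) `α`-stable law, `α ≠ 1`, with scale `σ`, skewness `β` and
location `m`: its characteristic function is
`t ↦ exp (i m t - σ^α |t|^α (1 - i β sgn(t) tan (π α / 2)))`. -/
structure IsStableLaw (α σ β m : ℝ) (ν : Measure ℝ) : Prop where
  scale_pos : 0 < σ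
  skewness_mem : β ∈ Set.Icc (-1 : ℝ) 1
  charFun_eq : ∀ t : ℝ, charFun ν t =
    Complex.exp (Complex.I * (m * t : ℝ) - (σ ^ α * |t| ^ α : ℝ) *
      (1 - Complex.I * (β * SignType.sign t * Real.tan (Real.pi * α / 2) : ℝ)))

/-- `ν` is a spectrally positive `α`-stable law, that is, `α`-stable and totally skewed to the
right (skewness `1`), so that its Lévy measure is carried by `(0, ∞)`. -/
def IsSpectrallyPositiveStable (α : ℝ) (ν : Measure ℝ) : Prop :=
  ∃ σ m : ℝ, IsStableLaw α σ 1 m ν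

/-- The random walks with rotationally invariant increments `R i • U d i` in `ℝ^d`, `d ≥ 1`:
the radial parts `R i` are i.i.d., non-negative, with second moment one and do not depend on `d`;
for each `d` the directions `U d i` are i.i.d. uniform on the unit sphere of `ℝ^d`, and the
sequence of directions is independent of the sequence of radial parts. -/
structure IsRotationInvariantModel {Ω : Type*} [MeasurableSpace Ω] (P : Measure Ω)
    (R : ℕ → Ω → ℝ) (U : (d : ℕ) → ℕ → Ω → EuclideanSpace ℝ (Fin d)) : Prop where
  measurable_radial : ∀ i, Measurable (R i)
  radial_nonneg : ∀ i, ∀ᵐ ω ∂P, 0 ≤ R i ω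
  radial_identDistrib : ∀ i, IdentDistrib (R i) (R 0) P P
  radial_iIndep : iIndepFun R P
  radial_second_moment : ∫ ω, (R 0 ω) ^ 2 ∂P = 1
  measurable_direction : ∀ d, 0 < d → ∀ i, Measurable (U d i)
  direction_uniform : ∀ d, 0 < d → ∀ i, P.map (U d i) = uniformUnitSphere d
  direction_iIndep : ∀ d, 0 < d → iIndepFun (U d) P
  radial_indep_direction : ∀ d, 0 < d →
    IndepFun (fun ω (i : ℕ) => R i ω) (fun ω (i : ℕ) => U d i ω) P

/-- The position `S_m^{(d)}` of the `d`-dimensional walk after `m` steps. -/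
noncomputable def walk {Ω : Type*} (R : ℕ → Ω → ℝ)
    (U : (d : ℕ) → ℕ → Ω → EuclideanSpace ℝ (Fin d)) (d m : ℕ) (ω : Ω) :
    EuclideanSpace ℝ (Fin d) :=
  ∑ i ∈ Finset.range m, R i ω • U d i ω

open scoped ENNReal RealInnerProductSpace

/-! The squared norm of the walk is a diagonal part `∑ R_i²` plus the off-diagonal part `offDiag`,
that is `2 ∑_{i<j} R_i R_j ⟪U_i, U_j⟫`. The centred diagonal part lives on the scale `n^(1/α) L(n)`
and has the stable limit by assumption. The off-diagonal part lives on the scale `n/√d`, whatever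
the tail of `R`, and is asymptotically Gaussian there. The two scales cross, up to `L`, at `n =
d^(α/(2α-2))`. The polynomial margin `δ` absorbs `L` by Potter bounds
(`IsSlowlyVarying.eventually_rpow_bounds`), so one part dominates and Slutsky's argument discards
the other.

The Gaussian limit is proved with the radii frozen at `r_i`. Directions are realised as `g_i/‖g_i‖`
with independent standard Gaussian `g_i`, and `⟪U_i, U_j⟫` is replaced by `⟪g_i, g_j⟫/d`. Pair terms
are orthogonal by sign symmetry, so the errors add up in `L²`. The Gaussian off-diagonal sum is `‖∑
r_i g_i‖²` minus its diagonal, and `∑ r_i g_i` is exactly `√(∑ r_i²)` times a standard Gaussian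
vector. What remains is the central limit theorem for the chi-square law. The bound
`norm_integral_cexp_offDiag_sub_le` needs only `∑ r_i² / n → 1` and `∑ r_i⁴ / n² → 0`. Both hold
almost surely: the first is the strong law, and the second follows from the first by
`tendsto_sum_sq_div_sq_of_tendsto_sum_div`, without a fourth moment. Dominated convergence then
removes the conditioning. -/

/-! ### Moments of the one-dimensional Gaussian. -/

lemma integral_pow_four_gaussianReal : ∫ x, x ^ 4 ∂(gaussianReal 0 1) = 3 := by
  rw [integral_gaussianReal_eq_integral_smul one_ne_zero]
  have h1 : ∀ x : ℝ, gaussianPDFReal 0 1 x • x ^ 4 =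
      (√(2 * Real.pi))⁻¹ * (fun y : ℝ => y ^ (4 : ℝ) * Real.exp (-(1 / 2) * y ^ (2 : ℝ))) |x| := by
    intro x
    have h4 : |x| ^ (4 : ℝ) = x ^ 4 := by
      rw [show (4 : ℝ) = ((4 : ℕ) : ℝ) by norm_num, Real.rpow_natCast]
      exact Even.pow_abs (by decide) x
    have h2 : |x| ^ (2 : ℝ) = x ^ 2 := by
      rw [show (2 : ℝ) = ((2 : ℕ) : ℝ) by norm_num, Real.rpow_natCast]
      exact Even.pow_abs (by decide) x
    simp only [h4, h2, gaussianPDFReal, smul_eq_mul, NNReal.coe_one, mul_one, sub_zero]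
    rw [show -x ^ 2 / 2 = -(1 / 2) * x ^ 2 by ring]
    ring
  simp_rw [h1]
  rw [integral_const_mul, integral_comp_abs
    (f := fun y : ℝ => y ^ (4 : ℝ) * Real.exp (-(1 / 2) * y ^ (2 : ℝ))),
    integral_rpow_mul_exp_neg_mul_rpow (by norm_num) (by norm_num) (by norm_num)]
  rw [show ((4 : ℝ) + 1) / 2 = ((2 : ℕ) : ℝ) + 1 / 2 by norm_num, Real.Gamma_nat_add_half,
    show -((4 : ℝ) + 1) / 2 = -((2 : ℕ) : ℝ) - 1 / 2 by norm_num,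
    Real.rpow_sub (by norm_num), Real.rpow_neg (by norm_num), Real.rpow_natCast,
    ← Real.sqrt_eq_rpow, Real.sqrt_mul (by norm_num)]
  have h2 : √(1 / 2) = (√2)⁻¹ := by rw [one_div, Real.sqrt_inv]
  have hp : √Real.pi ≠ 0 := by positivity
  have h22 : √2 ≠ 0 := by positivity
  rw [h2]
  simp [Nat.doubleFactorial]
  field_simp

lemma integral_sq_gaussianReal : ∫ x, x ^ 2 ∂(gaussianReal 0 1) = 1 := by
  have h := variance_id_gaussianReal (μ := 0) (v := 1)
  rw [variance_eq_integral (by fun_prop)] at h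
  simpa [integral_id_gaussianReal] using h

lemma integrable_pow_gaussianReal (k : ℕ) : Integrable (fun x : ℝ => x ^ k) (gaussianReal 0 1) := by
  have h : MemLp id (k : ℝ≥0∞) (gaussianReal 0 1) := by
    simpa using memLp_id_gaussianReal' (μ := 0) (v := 1) (k : ℝ≥0∞) (by simp)
  simpa using h.integrable_norm_pow'.mono (by fun_prop) (by simp)

/-! ### Density and polar decomposition of the standard Gaussian vector. -/

section Polar

variable {E : Type*} [NormedAddCommGroup E] [InnerProductSpace ℝ E] [FiniteDimensional ℝ E]
  [MeasurableSpace E] [BorelSpace E]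

/-- Both sides have the same characteristic function. The point is that the density is radial, which
is what the polar decomposition uses. -/
lemma stdGaussian_eq_withDensity :
    stdGaussian E = volume.withDensity (fun x : E => ENNReal.ofReal
      ((2 * Real.pi) ^ (-(Module.finrank ℝ E / 2 : ℝ)) * Real.exp (-(1 / 2) * ‖x‖ ^ 2))) := by
  set c : ℝ := (2 * Real.pi) ^ (-(Module.finrank ℝ E / 2 : ℝ)) with hc
  have hc0 : 0 ≤ c := by positivity
  have hI : Integrable (fun x : E => c * Real.exp (-(1 / 2) * ‖x‖ ^ 2)) := by
    refine Integrable.const_mul ?_ c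
    have := GaussianFourier.integrable_cexp_neg_mul_sq_norm_add (V := E) (b := 1 / 2)
      (by norm_num) 0 0
    refine this.norm.congr (ae_of_all _ fun x => ?_)
    simp only [Complex.norm_exp]
    congr 1
    simp [← Complex.ofReal_pow]
  have : IsFiniteMeasure (volume.withDensity (fun x : E => ENNReal.ofReal
      (c * Real.exp (-(1 / 2) * ‖x‖ ^ 2)))) := by
    refine isFiniteMeasure_withDensity_ofReal hI.2
  refine Measure.ext_of_charFun ?_
  ext t
  rw [charFun_stdGaussian, charFun_apply,
    integral_withDensity_eq_integral_toReal_smul (by fun_prop) (by simp)]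
  have h1 : ∀ x : E, (ENNReal.ofReal (c * Real.exp (-(1 / 2) * ‖x‖ ^ 2))).toReal •
      Complex.exp (⟪x, t⟫ * Complex.I) =
      (c : ℂ) * Complex.exp (-(1 / 2) * ‖x‖ ^ 2 + Complex.I * ⟪t, x⟫) := by
    intro x
    rw [ENNReal.toReal_ofReal (by positivity), Complex.exp_add, real_inner_comm]
    simp only [Complex.real_smul, Complex.ofReal_mul, Complex.ofReal_exp]
    push_cast
    ring_nf
  simp_rw [h1]
  rw [integral_const_mul, GaussianFourier.integral_cexp_neg_mul_sq_norm_add (by norm_num)]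
  have h2 : ((Real.pi : ℂ) / (1 / 2)) ^ (Module.finrank ℝ E / 2 : ℂ) =
      (((2 * Real.pi) ^ (Module.finrank ℝ E / 2 : ℝ) : ℝ) : ℂ) := by
    rw [Complex.ofReal_cpow (by positivity)]
    push_cast
    congr 1
    ring
  rw [h2, ← mul_assoc, ← Complex.ofReal_mul, hc, ← Real.rpow_add (by positivity)]
  simp
  ring_nf

lemma stdGaussian_map_neg : (stdGaussian E).map (fun x => -x) = stdGaussian E :=
  stdGaussian_map (LinearIsometryEquiv.neg ℝ)

end Polar

/-- The direction of a vector (and `0` for the zero vector). -/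
noncomputable def unitDirection {E : Type*} [NormedAddCommGroup E] [NormedSpace ℝ E] (x : E) : E :=
  ‖x‖⁻¹ • x

section Direction

variable {E : Type*} [NormedAddCommGroup E] [NormedSpace ℝ E]

lemma norm_unitDirection {x : E} (hx : x ≠ 0) : ‖unitDirection x‖ = 1 := by
  simp [unitDirection, norm_smul, hx]

lemma norm_unitDirection_le (x : E) : ‖unitDirection x‖ ≤ 1 := by
  rcases eq_or_ne x 0 with rfl | hx
  · simp [unitDirection]
  · exact (norm_unitDirection hx).le

lemma unitDirection_neg (x : E) : unitDirection (-x) = -unitDirection x := by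
  simp [unitDirection]

lemma norm_smul_unitDirection (x : E) : ‖x‖ • unitDirection x = x := by
  rcases eq_or_ne x 0 with rfl | hx
  · simp [unitDirection]
  · simp [unitDirection, hx]

@[fun_prop]
lemma measurable_unitDirection [MeasurableSpace E] [BorelSpace E] [SecondCountableTopology E] :
    Measurable (unitDirection : E → E) := by
  unfold unitDirection; fun_prop

end Direction

section PolarRectangles

variable {E : Type*} [NormedAddCommGroup E] [InnerProductSpace ℝ E] [FiniteDimensional ℝ E]
  [MeasurableSpace E] [BorelSpace E]

/-- A finite measure with a radial density is a product measure in polar coordinates. -/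
lemma withDensity_norm_polar_rectangle [Nontrivial E] (μ : Measure E) [μ.IsAddHaarMeasure]
    {ρ : ℝ → ℝ≥0∞} (hρ : Measurable ρ) {s : Set E} {t : Set ℝ}
    (hs : MeasurableSet s) (ht : MeasurableSet t) :
    (μ.withDensity (fun x => ρ ‖x‖)).map (fun x => (unitDirection x, ‖x‖)) (s ×ˢ t) =
      μ.toSphere (Subtype.val ⁻¹' s) *
        ∫⁻ r, t.indicator ρ (r : ℝ) ∂(Measure.volumeIoiPow (Module.finrank ℝ E - 1)) := by
  rw [Measure.map_apply (by fun_prop) (hs.prod ht),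
    withDensity_apply _ ((hs.prod ht).preimage (by fun_prop)),
    ← lintegral_indicator ((hs.prod ht).preimage (by fun_prop)),
    ← lintegral_add_compl _ (measurableSet_singleton (0 : E))]
  -- The origin, where polar coordinates are undefined, is a null set.
  rw [setLIntegral_measure_zero {(0 : E)} _ (by simp), zero_add,
    ← lintegral_subtype_comap (measurableSet_singleton (0 : E)).compl]
  have h1 : ∀ x : ({0}ᶜ : Set E),
      ((fun x : E => (unitDirection x, ‖x‖)) ⁻¹' s ×ˢ t).indicator (fun x => ρ ‖x‖) (x : E) =
      (fun p : Metric.sphere (0 : E) 1 × Set.Ioi (0 : ℝ) =>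
        (Subtype.val ⁻¹' s).indicator (fun _ => (1 : ℝ≥0∞)) p.1 * t.indicator ρ (p.2 : ℝ))
        (homeomorphUnitSphereProd E x) := by
    intro x
    have ha : ((homeomorphUnitSphereProd E x).1 : E) = unitDirection (x : E) := by
      simp [unitDirection]
    have hb : ((homeomorphUnitSphereProd E x).2 : ℝ) = ‖(x : E)‖ := by simp
    by_cases h1 : unitDirection (x : E) ∈ s <;> by_cases h2 : ‖(x : E)‖ ∈ t <;>
      simp [Set.indicator, ha, hb, h1, h2]
  simp_rw [h1]
  rw [(Measure.measurePreserving_homeomorphUnitSphereProd μ).lintegral_comp_emb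
    (Homeomorph.measurableEmbedding _) (fun p : Metric.sphere (0 : E) 1 × Set.Ioi (0 : ℝ) =>
      (Subtype.val ⁻¹' s).indicator (fun _ => (1 : ℝ≥0∞)) p.1 * t.indicator ρ (p.2 : ℝ))]
  rw [lintegral_prod_mul
    (f := (Subtype.val ⁻¹' s : Set (Metric.sphere (0 : E) 1)).indicator fun _ => (1 : ℝ≥0∞))
    (g := fun r : Set.Ioi (0 : ℝ) => t.indicator ρ (r : ℝ))]
  · rw [lintegral_indicator_const (hs.preimage measurable_subtype_coe), one_mul]
  · exact (measurable_const.indicator (hs.preimage measurable_subtype_coe)).aemeasurable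
  · exact ((hρ.indicator ht).comp measurable_subtype_coe).aemeasurable

end PolarRectangles

section UniformSphere

variable {d : ℕ}

lemma toSphere_univ_ne_zero (hd : 0 < d) :
    (volume : Measure (EuclideanSpace ℝ (Fin d))).toSphere Set.univ ≠ 0 := by
  have : Nonempty (Fin d) := ⟨⟨0, hd⟩⟩
  have : Nontrivial (EuclideanSpace ℝ (Fin d)) := inferInstance
  exact Measure.measure_univ_ne_zero.2 (Measure.toSphere_ne_zero _)

lemma isProbabilityMeasure_uniformUnitSphere (hd : 0 < d) :
    IsProbabilityMeasure (uniformUnitSphere d) := by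
  have h0 := toSphere_univ_ne_zero hd
  constructor
  rw [uniformUnitSphere, Measure.map_apply measurable_subtype_coe .univ, Set.preimage_univ,
    Measure.smul_apply, smul_eq_mul, ENNReal.inv_mul_cancel h0 (measure_ne_top _ _)]

/-- Polar decomposition of the standard Gaussian vector: its direction is uniform on the sphere
and independent of its norm. -/
lemma stdGaussian_map_unitDirection_norm (hd : 0 < d) :
    (stdGaussian (EuclideanSpace ℝ (Fin d))).map (fun x => (unitDirection x, ‖x‖)) =
      (uniformUnitSphere d).prod ((stdGaussian (EuclideanSpace ℝ (Fin d))).map norm) := by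
  have : Nonempty (Fin d) := ⟨⟨0, hd⟩⟩
  have := isProbabilityMeasure_uniformUnitSphere hd
  have : Nontrivial (EuclideanSpace ℝ (Fin d)) := inferInstance
  set c : ℝ := (2 * Real.pi) ^ (-(Module.finrank ℝ (EuclideanSpace ℝ (Fin d)) / 2 : ℝ))
  have hρ : Measurable fun r : ℝ => ENNReal.ofReal (c * Real.exp (-(1 / 2) * r ^ 2)) := by fun_prop
  have key := fun (s : Set (EuclideanSpace ℝ (Fin d))) (t : Set ℝ) hs ht =>
    withDensity_norm_polar_rectangle (s := s) (t := t) volume hρ hs ht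
  rw [← stdGaussian_eq_withDensity] at key
  generalize (fun r : ℝ => ENNReal.ofReal (c * Real.exp (-(1 / 2) * r ^ 2))) = ρ at key
  set τ := (volume : Measure (EuclideanSpace ℝ (Fin d))).toSphere
  set κ := Measure.volumeIoiPow (Module.finrank ℝ (EuclideanSpace ℝ (Fin d)) - 1)
  have h0 := toSphere_univ_ne_zero hd
  -- Taking the whole space as the set of directions identifies the radial factor and fixes the
  -- normalising constant.
  have hnorm : ∀ t : Set ℝ, MeasurableSet t → (stdGaussian (EuclideanSpace ℝ (Fin d))).map norm t =
      τ Set.univ * ∫⁻ r, t.indicator ρ (r : ℝ) ∂κ := by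
    intro t ht
    have := key Set.univ t .univ ht
    rw [Measure.map_apply (by fun_prop) (MeasurableSet.univ.prod ht)] at this
    rw [Measure.map_apply (by fun_prop) ht, ← Set.preimage_univ (f := Subtype.val), ← this]
    congr 1
    ext x; simp
  have : IsProbabilityMeasure ((stdGaussian (EuclideanSpace ℝ (Fin d))).map norm) :=
    Measure.isProbabilityMeasure_map (by fun_prop)
  symm
  refine Measure.prod_eq fun s t hs ht => ?_
  rw [key s t hs ht, hnorm t ht, uniformUnitSphere, Measure.map_apply measurable_subtype_coe hs,
    Measure.smul_apply, smul_eq_mul]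
  rw [mul_comm (τ Set.univ)⁻¹, mul_assoc, ← mul_assoc (τ Set.univ)⁻¹,
    ENNReal.inv_mul_cancel h0 (measure_ne_top _ _), one_mul]

lemma stdGaussian_map_unitDirection (hd : 0 < d) :
    (stdGaussian (EuclideanSpace ℝ (Fin d))).map unitDirection = uniformUnitSphere d := by
  have h := congrArg Measure.fst (stdGaussian_map_unitDirection_norm hd)
  have : IsProbabilityMeasure ((stdGaussian (EuclideanSpace ℝ (Fin d))).map norm) :=
    Measure.isProbabilityMeasure_map (by fun_prop)
  have := isProbabilityMeasure_uniformUnitSphere hd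
  rw [Measure.fst_prod, Measure.fst, Measure.map_map (by fun_prop) (by fun_prop)] at h
  exact h

lemma indepFun_unitDirection_norm (hd : 0 < d) :
    IndepFun unitDirection norm (stdGaussian (EuclideanSpace ℝ (Fin d))) := by
  rw [indepFun_iff_map_prod_eq_prod_map_map (by fun_prop) (by fun_prop),
    stdGaussian_map_unitDirection hd, stdGaussian_map_unitDirection_norm hd]

lemma ae_norm_eq_one_uniformUnitSphere : ∀ᵐ u ∂(uniformUnitSphere d), ‖u‖ = 1 := by
  rw [uniformUnitSphere, ae_map_iff (by fun_prop) (measurableSet_eq_fun (by fun_prop) (by fun_prop))]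
  exact ae_of_all _ fun u => by simp

end UniformSphere

/-! ### Second and fourth order moments of the Gaussian vector. -/

section GaussianMoments

variable {E : Type*} [NormedAddCommGroup E] [InnerProductSpace ℝ E] [FiniteDimensional ℝ E]
  [MeasurableSpace E] [BorelSpace E]

lemma integrable_inner_sq_stdGaussian (v : E) :
    Integrable (fun x : E => ⟪x, v⟫ ^ 2) (stdGaussian E) := by
  have h : MemLp (fun x : E => ⟪x, v⟫) 2 (stdGaussian E) :=
    (IsGaussian.memLp_two_id (μ := stdGaussian E)).inner_const v
  exact h.integrable_sq

lemma integral_inner_sq_stdGaussian (v : E) :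
    ∫ x, ⟪x, v⟫ ^ 2 ∂(stdGaussian E) = ‖v‖ ^ 2 := by
  have h := variance_dual_stdGaussian (innerSL ℝ v)
  rw [variance_eq_integral (by fun_prop), integral_strongDual_stdGaussian] at h
  simpa [real_inner_comm] using h

variable {d : ℕ}

lemma stdGaussian_integral_comp {F : Type*} [NormedAddCommGroup F] [NormedSpace ℝ F]
    (f : EuclideanSpace ℝ (Fin d) → F) (hf : Continuous f) :
    ∫ x, f x ∂(stdGaussian (EuclideanSpace ℝ (Fin d))) =
      ∫ y, f (WithLp.toLp 2 y) ∂(Measure.pi (fun _ : Fin d => gaussianReal 0 1)) := by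
  rw [← map_pi_eq_stdGaussian, integral_map (by fun_prop) hf.aestronglyMeasurable]

lemma integrable_norm_sq_stdGaussian :
    Integrable (fun x : E => ‖x‖ ^ 2) (stdGaussian E) :=
  (IsGaussian.memLp_two_id (μ := stdGaussian E)).norm.integrable_sq

lemma memLp_norm_sq_stdGaussian :
    MemLp (fun x : E => ‖x‖ ^ 2) 2 (stdGaussian E) := by
  have h : MemLp id ((4 : ℕ) : ℝ≥0∞) (stdGaussian E) := IsGaussian.memLp_id _ _ (by simp)
  rw [memLp_two_iff_integrable_sq (by fun_prop)]
  refine h.integrable_norm_pow'.congr (ae_of_all _ fun x => ?_)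
  simp only [id]; ring

lemma variance_sq_gaussianReal : Var[fun x : ℝ => x ^ 2; gaussianReal 0 1] = 2 := by
  rw [variance_eq_sub, integral_sq_gaussianReal]
  · have : ∫ x, ((fun x : ℝ => x ^ 2) ^ 2) x ∂(gaussianReal 0 1) = 3 := by
      rw [← integral_pow_four_gaussianReal]
      congr 1; ext x; simp only [Pi.pow_apply]; ring
    rw [this]; norm_num
  · rw [memLp_two_iff_integrable_sq (by fun_prop)]
    refine (integrable_pow_gaussianReal 4).congr (ae_of_all _ fun x => ?_)
    ring

lemma integral_norm_sq_stdGaussian :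
    ∫ x, ‖x‖ ^ 2 ∂(stdGaussian (EuclideanSpace ℝ (Fin d))) = d := by
  rw [stdGaussian_integral_comp _ (by fun_prop)]
  simp_rw [EuclideanSpace.real_norm_sq_eq]
  rw [integral_finsetSum]
  · have : ∀ i : Fin d, ∫ y : Fin d → ℝ, y i ^ 2 ∂(Measure.pi fun _ : Fin d => gaussianReal 0 1)
        = 1 := fun i => by
      rw [integral_comp_eval (μ := fun _ : Fin d => gaussianReal 0 1) (i := i)
        (f := fun x : ℝ => x ^ 2) (by fun_prop), integral_sq_gaussianReal]
    simp [this]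
  · intro i _
    exact integrable_comp_eval (μ := fun _ : Fin d => gaussianReal 0 1) (i := i)
        (f := fun x : ℝ => x ^ 2) (integrable_pow_gaussianReal 2)

lemma variance_norm_sq_stdGaussian :
    Var[fun x => ‖x‖ ^ 2; stdGaussian (EuclideanSpace ℝ (Fin d))] = 2 * d := by
  rw [← map_pi_eq_stdGaussian, variance_map (by fun_prop) (by fun_prop)]
  have : (fun x : EuclideanSpace ℝ (Fin d) => ‖x‖ ^ 2) ∘ WithLp.toLp 2 =
      ∑ i : Fin d, (fun y : Fin d → ℝ => y i ^ 2) := by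
    ext y; simp [EuclideanSpace.real_norm_sq_eq]
  rw [this, variance_sum_pi (X := fun (_ : Fin d) (x : ℝ) => x ^ 2)]
  · simp [variance_sq_gaussianReal, mul_comm]
  · intro i
    rw [memLp_two_iff_integrable_sq (by fun_prop)]
    refine (integrable_pow_gaussianReal 4).congr (ae_of_all _ fun x => ?_)
    ring

end GaussianMoments

/-- The pairs `(i, j)` with `i < j`. -/
def ltPairs (n : ℕ) : Finset (Fin n × Fin n) := Finset.univ.filter fun p => p.1 < p.2

/-! ### Orthogonality of sums over pairs. -/

section Orthogonality

variable {E : Type*} [MeasurableSpace E] {γ : Measure E} [IsProbabilityMeasure γ]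
  {h : E → E → ℝ} {n : ℕ}

lemma measurePreserving_eval_pair {i j : Fin n} (hij : i ≠ j) :
    MeasurePreserving (fun g : Fin n → E => (g i, g j)) (Measure.pi fun _ => γ) (γ.prod γ) := by
  refine ⟨by fun_prop, ?_⟩
  have hi := iIndepFun_pi (μ := fun _ : Fin n => γ) (X := fun _ x => x) (fun _ => aemeasurable_id)
  have := (hi.indepFun hij)
  rw [indepFun_iff_map_prod_eq_prod_map_map (measurable_pi_apply i).aemeasurable
    (measurable_pi_apply j).aemeasurable] at this
  rw [this]
  congr 1
  · exact (measurePreserving_eval (fun _ : Fin n => γ) i).map_eq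
  · exact (measurePreserving_eval (fun _ : Fin n => γ) j).map_eq

lemma integrable_sq_pair (hm : Measurable (Function.uncurry h))
    (hint : Integrable (fun z : E × E => h z.1 z.2 ^ 2) (γ.prod γ))
    {p : Fin n × Fin n} (hp : p ∈ ltPairs n) :
    MemLp (fun g : Fin n → E => h (g p.1) (g p.2)) 2 (Measure.pi fun _ : Fin n => γ) := by
  simp only [ltPairs, Finset.mem_filter, Finset.mem_univ, true_and] at hp
  have : MemLp (fun z : E × E => h z.1 z.2) 2 (γ.prod γ) :=
    (memLp_two_iff_integrable_sq hm.aestronglyMeasurable).2 hint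
  exact this.comp_measurePreserving (measurePreserving_eval_pair hp.ne)

variable [AddCommGroup E]

lemma measurePreserving_neg_coord (hγ : MeasurePreserving (fun x : E => -x) γ γ) (a : Fin n) :
    MeasurePreserving (fun (g : Fin n → E) i => if i = a then -g i else g i)
      (Measure.pi fun _ => γ) (Measure.pi fun _ => γ) := by
  have := measurePreserving_pi (fun _ : Fin n => γ) (fun _ : Fin n => γ)
    (f := fun i x => if i = a then -x else x) (fun i => by
      by_cases hi : i = a
      · simpa [hi] using hγ
      · simpa [hi] using! MeasurePreserving.id γ)
  exact this

/-- Two different increasing pairs leave some index of `p` outside `q`. Flipping the sign of that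
coordinate preserves the measure and negates the integrand. -/
lemma integral_mul_pair_eq_zero (hγ : MeasurePreserving (fun x : E => -x) γ γ)
    (h1 : ∀ x y, h (-x) y = -h x y) (h2 : ∀ x y, h x (-y) = -h x y)
    (hm : Measurable (Function.uncurry h))
    {p q : Fin n × Fin n} (hp : p ∈ ltPairs n) (hq : q ∈ ltPairs n) (hpq : p ≠ q) :
    ∫ g, h (g p.1) (g p.2) * h (g q.1) (g q.2) ∂(Measure.pi fun _ : Fin n => γ) = 0 := by
  simp only [ltPairs, Finset.mem_filter, Finset.mem_univ, true_and] at hp hq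
  have flip : ∀ a : Fin n, (∀ g : Fin n → E,
      (fun g : Fin n → E => h (g p.1) (g p.2) * h (g q.1) (g q.2))
        (fun i => if i = a then -g i else g i) = -(h (g p.1) (g p.2) * h (g q.1) (g q.2))) →
      ∫ g, h (g p.1) (g p.2) * h (g q.1) (g q.2) ∂(Measure.pi fun _ : Fin n => γ) = 0 := by
    intro a ha
    have hmp := measurePreserving_neg_coord hγ a
    have hF : Measurable fun g : Fin n → E => h (g p.1) (g p.2) * h (g q.1) (g q.2) :=
      (hm.comp (by fun_prop : Measurable fun g : Fin n → E => (g p.1, g p.2))).mul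
        (hm.comp (by fun_prop : Measurable fun g : Fin n → E => (g q.1, g q.2)))
    have h3 := integral_map (μ := Measure.pi fun _ : Fin n => γ) hmp.aemeasurable
      (f := fun g : Fin n → E => h (g p.1) (g p.2) * h (g q.1) (g q.2)) hF.aestronglyMeasurable
    rw [hmp.map_eq] at h3
    rw [integral_congr_ae (ae_of_all _ ha), integral_neg] at h3
    linarith
  by_cases c1 : p.1 ≠ q.1 ∧ p.1 ≠ q.2
  · refine flip p.1 fun g => ?_
    simp [hp.ne', c1.1.symm, c1.2.symm, h1]
  by_cases c2 : p.2 ≠ q.1 ∧ p.2 ≠ q.2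
  · refine flip p.2 fun g => ?_
    simp [hp.ne, c2.1.symm, c2.2.symm, h2]
  -- Here both entries of `p` occur in `q`; as both pairs are increasing, they coincide.
  · exfalso
    apply hpq
    ext <;> grind

/-- Pythagoras: the cross terms vanish, and each pair of coordinates has law `γ.prod γ`. -/
lemma integral_sq_sum_ltPairs (hγ : MeasurePreserving (fun x : E => -x) γ γ)
    (h1 : ∀ x y, h (-x) y = -h x y) (h2 : ∀ x y, h x (-y) = -h x y)
    (hm : Measurable (Function.uncurry h))
    (hint : Integrable (fun z : E × E => h z.1 z.2 ^ 2) (γ.prod γ)) (c : Fin n × Fin n → ℝ) :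
    ∫ g, (∑ p ∈ ltPairs n, c p * h (g p.1) (g p.2)) ^ 2 ∂(Measure.pi fun _ : Fin n => γ) =
      (∫ z, h z.1 z.2 ^ 2 ∂(γ.prod γ)) * ∑ p ∈ ltPairs n, c p ^ 2 := by
  have hi : ∀ p ∈ ltPairs n, ∀ q ∈ ltPairs n, Integrable (fun g : Fin n → E =>
      (c p * h (g p.1) (g p.2)) * (c q * h (g q.1) (g q.2))) (Measure.pi fun _ : Fin n => γ) :=
    fun p hp q hq => ((integrable_sq_pair hm hint hp).const_mul _).integrable_mul
      ((integrable_sq_pair hm hint hq).const_mul _)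
  simp_rw [sq, Finset.sum_mul_sum]
  rw [integral_finsetSum _ fun p hp => integrable_finsetSum _ fun q hq => hi p hp q hq,
    Finset.mul_sum]
  refine Finset.sum_congr rfl fun p hp => ?_
  rw [integral_finsetSum _ fun q hq => hi p hp q hq, Finset.sum_eq_single_of_mem p hp]
  · have hp' := hp
    simp only [ltPairs, Finset.mem_filter, Finset.mem_univ, true_and] at hp'
    rw [← (measurePreserving_eval_pair (γ := γ) hp'.ne).map_eq, integral_map (by fun_prop)]
    · rw [← integral_mul_const]
      congr 1; ext g; ring
    · have := (hm.comp measurable_id).mul (hm.comp measurable_id)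
      exact this.aestronglyMeasurable
  · intro q hq hqp
    have : ∀ g : Fin n → E, (c p * h (g p.1) (g p.2)) * (c q * h (g q.1) (g q.2)) =
      (c p * c q) * (h (g p.1) (g p.2) * h (g q.1) (g q.2)) := fun g => by ring
    simp_rw [this]
    rw [integral_const_mul, integral_mul_pair_eq_zero hγ h1 h2 hm hp hq hqp.symm, mul_zero]

end Orthogonality

lemma sum_sq_eq_sum_add_two_mul_sum_ltPairs (n : ℕ) (f : Fin n → Fin n → ℝ)
    (hf : ∀ i j, f i j = f j i) :
    ∑ i, ∑ j, f i j = ∑ i, f i i + 2 * ∑ p ∈ ltPairs n, f p.1 p.2 := by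
  rw [← Fintype.sum_prod_type']
  have h3 : ∀ p : Fin n × Fin n, f p.1 p.2 = (if p.1 = p.2 then f p.1 p.2 else 0) +
      ((if p.1 < p.2 then f p.1 p.2 else 0) + (if p.2 < p.1 then f p.1 p.2 else 0)) := by
    intro p
    rcases lt_trichotomy p.1 p.2 with h | h | h
    · simp [h, h.ne, h.le]
    · simp [h]
    · simp [h, h.ne', h.le]
  rw [Finset.sum_congr rfl fun p _ => h3 p, Finset.sum_add_distrib, Finset.sum_add_distrib,
    two_mul]
  congr 1
  · rw [Fintype.sum_prod_type]
    simp
  · rw [ltPairs, Finset.sum_filter]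
    congr 1
    rw [← Equiv.sum_comp (Equiv.prodComm (Fin n) (Fin n))]
    refine Finset.sum_congr rfl fun p _ => ?_
    simp [hf p.2 p.1]

lemma norm_sq_sum_smul_eq {E : Type*} [NormedAddCommGroup E] [InnerProductSpace ℝ E] {n : ℕ}
    (r : Fin n → ℝ) (u : Fin n → E) :
    ‖∑ i, r i • u i‖ ^ 2 = ∑ i, r i ^ 2 * ‖u i‖ ^ 2 +
      2 * ∑ p ∈ ltPairs n, (r p.1 * r p.2) * ⟪u p.1, u p.2⟫ := by
  rw [← real_inner_self_eq_norm_sq, sum_inner]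
  simp_rw [inner_sum, real_inner_smul_left, real_inner_smul_right]
  rw [sum_sq_eq_sum_add_two_mul_sum_ltPairs n (fun i j => r i * (r j * ⟪u i, u j⟫))]
  · simp_rw [real_inner_self_eq_norm_sq]
    congr 1
    · refine Finset.sum_congr rfl fun i _ => by ring
    · congr 1
      refine Finset.sum_congr rfl fun i _ => by ring
  · intro i j
    rw [real_inner_comm]; ring

lemma two_mul_sum_ltPairs_sq_le {n : ℕ} (r : Fin n → ℝ) :
    2 * ∑ p ∈ ltPairs n, (r p.1 * r p.2) ^ 2 ≤ (∑ i, r i ^ 2) ^ 2 := by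
  rw [sq (∑ i, r i ^ 2), Finset.sum_mul_sum,
    sum_sq_eq_sum_add_two_mul_sum_ltPairs n (fun i j => r i ^ 2 * r j ^ 2) fun i j => mul_comm _ _]
  simp_rw [mul_pow]
  have : 0 ≤ ∑ i, r i ^ 2 * r i ^ 2 := Finset.sum_nonneg fun i _ => by positivity
  linarith

lemma integral_fun_sub_add {α : Type*} [MeasurableSpace α] {μ : Measure α} {f g h : α → ℝ}
    (hf : Integrable f μ) (hg : Integrable g μ) (hh : Integrable h μ) :
    ∫ x, f x - g x + h x ∂μ = ∫ x, f x ∂μ - ∫ x, g x ∂μ + ∫ x, h x ∂μ := by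
  rw [← integral_sub hf hg]
  exact integral_add (hf.sub hg) hh

/-! ### Directions compared with Gaussian vectors in mean square. -/

section DirectionMoments

variable {d : ℕ}

lemma ae_norm_unitDirection_eq_one (hd : 0 < d) :
    ∀ᵐ x ∂(stdGaussian (EuclideanSpace ℝ (Fin d))), ‖unitDirection x‖ = 1 := by
  have h := ae_norm_eq_one_uniformUnitSphere (d := d)
  rw [← stdGaussian_map_unitDirection hd] at h
  exact ae_of_ae_map (by fun_prop) h

/-- Norm and direction are independent, so the mean of `⟪x, v⟫ ^ 2` factors as `d` times the wanted
integral. -/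
lemma integral_inner_unitDirection_sq (hd : 0 < d) (v : EuclideanSpace ℝ (Fin d)) :
    ∫ x, ⟪unitDirection x, v⟫ ^ 2 ∂(stdGaussian (EuclideanSpace ℝ (Fin d))) = ‖v‖ ^ 2 / d := by
  have hi : IndepFun (fun x : EuclideanSpace ℝ (Fin d) => ‖x‖ ^ 2)
      (fun x => ⟪unitDirection x, v⟫ ^ 2) (stdGaussian (EuclideanSpace ℝ (Fin d))) :=
    (indepFun_unitDirection_norm hd).symm.comp (φ := fun r => r ^ 2) (ψ := fun u => ⟪u, v⟫ ^ 2)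
      (by fun_prop) (by fun_prop)
  have h := hi.integral_fun_mul_eq_mul_integral (by fun_prop) (by fun_prop)
  rw [integral_norm_sq_stdGaussian] at h
  have h2 : ∀ x : EuclideanSpace ℝ (Fin d),
      ‖x‖ ^ 2 * ⟪unitDirection x, v⟫ ^ 2 = ⟪x, v⟫ ^ 2 := fun x => by
    conv_rhs => rw [← norm_smul_unitDirection x]
    rw [real_inner_smul_left, mul_pow]
  simp_rw [h2] at h
  rw [integral_inner_sq_stdGaussian] at h
  rw [h]
  field_simp

lemma integral_norm_mul_inner_unitDirection_sq (hd : 0 < d) (v : EuclideanSpace ℝ (Fin d)) :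
    ∫ x, ‖x‖ * ⟪unitDirection x, v⟫ ^ 2 ∂(stdGaussian (EuclideanSpace ℝ (Fin d))) =
      (∫ x, ‖x‖ ∂(stdGaussian (EuclideanSpace ℝ (Fin d)))) * (‖v‖ ^ 2 / d) := by
  have hi : IndepFun (fun x : EuclideanSpace ℝ (Fin d) => ‖x‖)
      (fun x => ⟪unitDirection x, v⟫ ^ 2) (stdGaussian (EuclideanSpace ℝ (Fin d))) :=
    (indepFun_unitDirection_norm hd).symm.comp (φ := fun r => r) (ψ := fun u => ⟪u, v⟫ ^ 2)
      (by fun_prop) (by fun_prop)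
  rw [← integral_inner_unitDirection_sq hd]
  exact hi.integral_fun_mul_eq_mul_integral (by fun_prop) (by fun_prop)

/-- Since `(‖x‖ - √d)² ≤ (‖x‖² - d)² / d` and the right side has mean `2`, expanding the left side
bounds the mean norm from below. -/
lemma sub_one_le_sqrt_mul_integral_norm (hd : 0 < d) :
    (d : ℝ) - 1 ≤ √d * ∫ x, ‖x‖ ∂(stdGaussian (EuclideanSpace ℝ (Fin d))) := by
  have hd' : (0 : ℝ) < d := by exact_mod_cast hd
  have hs : √(d : ℝ) ^ 2 = d := Real.sq_sqrt hd'.le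
  have hn : Integrable (fun x : EuclideanSpace ℝ (Fin d) => ‖x‖)
      (stdGaussian (EuclideanSpace ℝ (Fin d))) := IsGaussian.integrable_id.norm
  have hv := variance_norm_sq_stdGaussian (d := d)
  rw [variance_eq_integral (by fun_prop), integral_norm_sq_stdGaussian] at hv
  have hm := memLp_norm_sq_stdGaussian (E := EuclideanSpace ℝ (Fin d))
  have h1 : ∫ x : EuclideanSpace ℝ (Fin d), (‖x‖ - √d) ^ 2 ∂(stdGaussian _) ≤
      ∫ x : EuclideanSpace ℝ (Fin d), (‖x‖ ^ 2 - d) ^ 2 / d ∂(stdGaussian _) := by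
    refine integral_mono_of_nonneg (ae_of_all _ fun x => by positivity)
      ((hm.sub (memLp_const (d : ℝ))).integrable_sq.div_const _) (ae_of_all _ fun x => ?_)
    simp only
    rw [le_div_iff₀ hd']
    have : (‖x‖ ^ 2 - (d : ℝ)) ^ 2 = (‖x‖ - √d) ^ 2 * (‖x‖ + √d) ^ 2 := by
      rw [← mul_pow, ← hs]; simp only [Real.sqrt_sq (Real.sqrt_nonneg _)]; ring
    rw [this]
    refine mul_le_mul_of_nonneg_left ?_ (by positivity)
    nlinarith [norm_nonneg x, Real.sqrt_nonneg (d : ℝ)]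
  rw [integral_div, hv] at h1
  have h2 : ∀ x : EuclideanSpace ℝ (Fin d), (‖x‖ - √d) ^ 2 = ‖x‖ ^ 2 - 2 * √d * ‖x‖ + d := by
    intro x; linear_combination hs
  simp_rw [h2] at h1
  rw [integral_fun_sub_add integrable_norm_sq_stdGaussian (hn.const_mul _) (integrable_const _),
    integral_norm_sq_stdGaussian,
    integral_const_mul] at h1
  have h3 : 2 * (d : ℝ) / d = 2 := by field_simp
  simp at h1
  rw [h3] at h1
  linarith

lemma integrable_inner_unitDirection_sq_prod :
    Integrable (fun z : EuclideanSpace ℝ (Fin d) × EuclideanSpace ℝ (Fin d) =>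
      ⟪unitDirection z.1, unitDirection z.2⟫ ^ 2)
      ((stdGaussian (EuclideanSpace ℝ (Fin d))).prod
        (stdGaussian (EuclideanSpace ℝ (Fin d)))) := by
  refine Integrable.of_bound (by fun_prop) 1 (ae_of_all _ fun z => ?_)
  have h := abs_real_inner_le_norm (unitDirection z.1) (unitDirection z.2)
  have h1 := norm_unitDirection_le z.1
  have h2 := norm_unitDirection_le z.2
  have h3 : |⟪unitDirection z.1, unitDirection z.2⟫| ≤ 1 :=
    h.trans (mul_le_one₀ h1 (norm_nonneg _) h2)
  simpa [sq_abs] using h3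

lemma integral_inner_unitDirection_sq_prod (hd : 0 < d) :
    ∫ z : EuclideanSpace ℝ (Fin d) × EuclideanSpace ℝ (Fin d),
      ⟪unitDirection z.1, unitDirection z.2⟫ ^ 2
      ∂((stdGaussian (EuclideanSpace ℝ (Fin d))).prod
        (stdGaussian (EuclideanSpace ℝ (Fin d)))) = 1 / d := by
  rw [integral_prod_symm _ integrable_inner_unitDirection_sq_prod]
  simp_rw [integral_inner_unitDirection_sq hd]
  rw [integral_congr_ae (g := fun _ => (1 : ℝ) / d)]
  · simp
  · filter_upwards [ae_norm_unitDirection_eq_one hd] with x hx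
    simp [hx]

lemma integrable_inner_sq_prod :
    Integrable (fun z : EuclideanSpace ℝ (Fin d) × EuclideanSpace ℝ (Fin d) => ⟪z.1, z.2⟫ ^ 2)
      ((stdGaussian (EuclideanSpace ℝ (Fin d))).prod
        (stdGaussian (EuclideanSpace ℝ (Fin d)))) := by
  refine ((integrable_norm_sq_stdGaussian (E := EuclideanSpace ℝ (Fin d))).mul_prod
    (integrable_norm_sq_stdGaussian (E := EuclideanSpace ℝ (Fin d)))).mono (by fun_prop)
    (ae_of_all _ fun z => ?_)
  have h := abs_real_inner_le_norm z.1 z.2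
  simp only [norm_pow, Real.norm_eq_abs, norm_mul, abs_norm]
  rw [← mul_pow]
  gcongr

lemma integrable_inner_unitDirection_sub_sq_prod :
    Integrable (fun z : EuclideanSpace ℝ (Fin d) × EuclideanSpace ℝ (Fin d) =>
      (⟪unitDirection z.1, unitDirection z.2⟫ - ⟪z.1, z.2⟫ / d) ^ 2)
      ((stdGaussian (EuclideanSpace ℝ (Fin d))).prod
        (stdGaussian (EuclideanSpace ℝ (Fin d)))) := by
  refine MemLp.integrable_sq (MemLp.sub ?_ ?_)
  · exact (memLp_two_iff_integrable_sq (by fun_prop)).2 integrable_inner_unitDirection_sq_prod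
  · refine (memLp_two_iff_integrable_sq (by fun_prop)).2 ?_
    simp_rw [div_pow]
    exact integrable_inner_sq_prod.div_const _

/-- With `m` the mean norm, independence of norm and direction makes the integral equal to `2/d -
2m²/d²`. The bound `m² ≥ (d-1)²/d` cancels the order `1/d`, one order better than the second moment
of either term. -/
lemma integral_inner_unitDirection_sub_sq_prod_le (hd : 0 < d) :
    ∫ z : EuclideanSpace ℝ (Fin d) × EuclideanSpace ℝ (Fin d),
      (⟪unitDirection z.1, unitDirection z.2⟫ - ⟪z.1, z.2⟫ / d) ^ 2
      ∂((stdGaussian (EuclideanSpace ℝ (Fin d))).prod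
        (stdGaussian (EuclideanSpace ℝ (Fin d)))) ≤ 4 / d ^ 2 := by
  have hd' : (0 : ℝ) < d := by exact_mod_cast hd
  have hd1 : (1 : ℝ) ≤ d := by exact_mod_cast hd
  have hn : Integrable (fun x : EuclideanSpace ℝ (Fin d) => ‖x‖)
      (stdGaussian (EuclideanSpace ℝ (Fin d))) := IsGaussian.integrable_id.norm
  rw [integral_prod_symm _ integrable_inner_unitDirection_sub_sq_prod]
  set m := ∫ x, ‖x‖ ∂(stdGaussian (EuclideanSpace ℝ (Fin d))) with hm
  have h1 : ∀ y : EuclideanSpace ℝ (Fin d), ∫ x,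
      (⟪unitDirection x, unitDirection y⟫ - ⟪x, y⟫ / d) ^ 2
        ∂(stdGaussian (EuclideanSpace ℝ (Fin d))) =
      ‖unitDirection y‖ ^ 2 / d - 2 / d * ‖y‖ * (m * (‖unitDirection y‖ ^ 2 / d)) +
        ‖y‖ ^ 2 / d ^ 2 := by
    intro y
    have h2 : ∀ x, (⟪unitDirection x, unitDirection y⟫ - ⟪x, y⟫ / d) ^ 2 =
        ⟪unitDirection x, unitDirection y⟫ ^ 2 -
          2 / d * ‖y‖ * (‖x‖ * ⟪unitDirection x, unitDirection y⟫ ^ 2) + ⟪x, y⟫ ^ 2 / d ^ 2 := by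
      intro x
      have : ⟪x, y⟫ = ‖x‖ * ‖y‖ * ⟪unitDirection x, unitDirection y⟫ := by
        conv_lhs => rw [← norm_smul_unitDirection x, ← norm_smul_unitDirection y]
        rw [real_inner_smul_left, real_inner_smul_right]; ring
      rw [sub_sq, div_pow, this]
      ring
    have hb : ∀ x, |⟪unitDirection x, unitDirection y⟫| ≤ 1 := fun x =>
      (abs_real_inner_le_norm _ _).trans
        (mul_le_one₀ (norm_unitDirection_le _) (norm_nonneg _) (norm_unitDirection_le _))
    have i1 : Integrable (fun x => ⟪unitDirection x, unitDirection y⟫ ^ 2)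
        (stdGaussian (EuclideanSpace ℝ (Fin d))) :=
      Integrable.of_bound (by fun_prop) 1 (ae_of_all _ fun x => by simpa [sq_abs] using hb x)
    have i2 : Integrable (fun x => ‖x‖ * ⟪unitDirection x, unitDirection y⟫ ^ 2)
        (stdGaussian (EuclideanSpace ℝ (Fin d))) := by
      refine hn.mono (by fun_prop) (ae_of_all _ fun x => ?_)
      have : ⟪unitDirection x, unitDirection y⟫ ^ 2 ≤ 1 := by simpa [sq_abs] using hb x
      simp only [norm_mul, norm_pow, Real.norm_eq_abs, sq_abs, abs_norm]
      exact mul_le_of_le_one_right (norm_nonneg _) this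
    simp_rw [h2]
    rw [integral_fun_sub_add i1 (i2.const_mul _) ((integrable_inner_sq_stdGaussian y).div_const _),
      integral_const_mul,
      integral_inner_unitDirection_sq hd, integral_norm_mul_inner_unitDirection_sq hd,
      integral_div, integral_inner_sq_stdGaussian]
  simp_rw [h1]
  rw [integral_congr_ae (g := fun y => 1 / (d : ℝ) - 2 * m / d ^ 2 * ‖y‖ + ‖y‖ ^ 2 / d ^ 2)]
  · rw [integral_fun_sub_add (integrable_const _) (hn.const_mul _)
      (integrable_norm_sq_stdGaussian.div_const _), integral_const_mul, integral_div, integral_div,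
      integral_norm_sq_stdGaussian, ← hm]
    have h5 := sub_one_le_sqrt_mul_integral_norm hd
    rw [← hm] at h5
    have h6 : ((d : ℝ) - 1) ^ 2 ≤ d * m ^ 2 := by
      have := pow_le_pow_left₀ (by linarith) h5 2
      rwa [mul_pow, Real.sq_sqrt hd'.le] at this
    simp only [integral_const, probReal_univ, one_smul]
    rw [show 1 / (d : ℝ) - 2 * m / d ^ 2 * m + d / d ^ 2 = (2 * d ^ 2 - 2 * (d * m ^ 2)) / d ^ 3 by
      field_simp; ring, div_le_div_iff₀ (by positivity) (by positivity)]
    have h7 : 2 * (d : ℝ) ^ 2 - 2 * (d * m ^ 2) ≤ 4 * d := by nlinarith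
    calc _ ≤ 4 * (d : ℝ) * d ^ 2 := by gcongr
      _ = _ := by ring
  · filter_upwards [ae_norm_unitDirection_eq_one hd] with y hy
    rw [hy]
    field_simp

end DirectionMoments

/-! ### From mean-square bounds to characteristic functions; the off-diagonal form. -/

/-- The map `x ↦ exp (i t x)` is `|t|`-Lipschitz, and the first absolute moment is at most the root
of the second. -/
lemma norm_integral_cexp_sub_le {α : Type*} [MeasurableSpace α] {μ : Measure α}
    [IsProbabilityMeasure μ] {X Y : α → ℝ} (hX : Measurable X) (hY : Measurable Y)
    (hXY : MemLp (fun x => X x - Y x) 2 μ) (t : ℝ) :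
    ‖∫ x, Complex.exp (Complex.I * (t * X x : ℝ)) ∂μ -
      ∫ x, Complex.exp (Complex.I * (t * Y x : ℝ)) ∂μ‖ ≤
      |t| * √(∫ x, (X x - Y x) ^ 2 ∂μ) := by
  have hb : ∀ x : ℝ, ‖Complex.exp (Complex.I * (x : ℝ))‖ = 1 := fun x => by
    rw [mul_comm]; exact Complex.norm_exp_ofReal_mul_I x
  rw [← integral_sub (Integrable.of_bound (by fun_prop) 1 (ae_of_all _ fun x => (hb _).le))
    (Integrable.of_bound (by fun_prop) 1 (ae_of_all _ fun x => (hb _).le))]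
  have h1 : ∀ x, ‖Complex.exp (Complex.I * (t * X x : ℝ)) -
      Complex.exp (Complex.I * (t * Y x : ℝ))‖ ≤ |t| * |X x - Y x| := by
    intro x
    have : Complex.exp (Complex.I * (t * X x : ℝ)) - Complex.exp (Complex.I * (t * Y x : ℝ)) =
        Complex.exp (Complex.I * (t * Y x : ℝ)) *
          (Complex.exp (Complex.I * (t * (X x - Y x) : ℝ)) - 1) := by
      rw [mul_sub, ← Complex.exp_add, mul_one]
      congr 2; push_cast; ring
    rw [this, norm_mul, hb, one_mul, ← abs_mul]
    exact Real.norm_exp_I_mul_ofReal_sub_one_le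
  have hint : Integrable (fun x => X x - Y x) μ := hXY.integrable (by norm_num)
  have h2 : (∫ x, |X x - Y x| ∂μ) ≤ √(∫ x, (X x - Y x) ^ 2 ∂μ) := by
    have hv := variance_nonneg (fun x => |X x - Y x|) μ
    rw [variance_eq_sub (by simpa using hXY.norm)] at hv
    refine Real.le_sqrt_of_sq_le ?_
    simp only [Pi.pow_apply, sq_abs] at hv
    linarith
  calc _ ≤ ∫ x, |t| * |X x - Y x| ∂μ := norm_integral_le_of_norm_le (hint.abs.const_mul _)
        (ae_of_all _ h1)
    _ = |t| * ∫ x, |X x - Y x| ∂μ := integral_const_mul _ _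
    _ ≤ _ := by gcongr

/-- The off-diagonal part `‖∑ rᵢ uᵢ‖² - ∑ rᵢ² ‖uᵢ‖²` of the squared norm of a weighted sum. -/
noncomputable def offDiag {E : Type*} [NormedAddCommGroup E] [InnerProductSpace ℝ E] {n : ℕ}
    (r : Fin n → ℝ) (u : Fin n → E) : ℝ :=
  2 * ∑ p ∈ ltPairs n, (r p.1 * r p.2) * ⟪u p.1, u p.2⟫

lemma measurable_offDiag {E : Type*} [NormedAddCommGroup E] [InnerProductSpace ℝ E]
    [MeasurableSpace E] [BorelSpace E] [SecondCountableTopology E] {n : ℕ} :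
    Measurable fun z : (Fin n → ℝ) × (Fin n → E) => offDiag z.1 z.2 := by
  unfold offDiag
  refine Measurable.const_mul (Finset.measurable_fun_sum _ fun p _ => ?_) _
  have h1 : Measurable fun z : (Fin n → ℝ) × (Fin n → E) => z.2 p.1 := by fun_prop
  have h2 : Measurable fun z : (Fin n → ℝ) × (Fin n → E) => z.2 p.2 := by fun_prop
  exact (by fun_prop : Measurable fun z : (Fin n → ℝ) × (Fin n → E) => z.1 p.1 * z.1 p.2).mul
    (h1.inner h2)

lemma measurable_offDiag_right {E : Type*} [NormedAddCommGroup E] [InnerProductSpace ℝ E]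
    [MeasurableSpace E] [BorelSpace E] [SecondCountableTopology E] {n : ℕ} (r : Fin n → ℝ) :
    Measurable fun u : Fin n → E => offDiag r u :=
  measurable_offDiag.comp (measurable_const.prodMk measurable_id)

/-! ### Mean-square estimates with frozen radii. -/

section FixedWeights

variable {d n : ℕ}

lemma memLp_sum_pair {h : EuclideanSpace ℝ (Fin d) → EuclideanSpace ℝ (Fin d) → ℝ}
    (hm : Measurable (Function.uncurry h))
    (hint : Integrable (fun z : EuclideanSpace ℝ (Fin d) × EuclideanSpace ℝ (Fin d) =>
      h z.1 z.2 ^ 2) ((stdGaussian _).prod (stdGaussian _))) (c : Fin n × Fin n → ℝ) :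
    MemLp (fun g : Fin n → EuclideanSpace ℝ (Fin d) => ∑ p ∈ ltPairs n, c p * h (g p.1) (g p.2)) 2
      (Measure.pi fun _ => stdGaussian _) :=
  memLp_finsetSum _ fun _ hp => (integrable_sq_pair hm hint hp).const_mul _

/-- Common source of two bounds: the size of the off-diagonal part, and the error of its Gaussian
replacement. -/
lemma integral_sq_sum_pair_le {h : EuclideanSpace ℝ (Fin d) → EuclideanSpace ℝ (Fin d) → ℝ}
    (h1 : ∀ x y, h (-x) y = -h x y) (h2 : ∀ x y, h x (-y) = -h x y)
    (hm : Measurable (Function.uncurry h))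
    (hint : Integrable (fun z : EuclideanSpace ℝ (Fin d) × EuclideanSpace ℝ (Fin d) =>
      h z.1 z.2 ^ 2) ((stdGaussian _).prod (stdGaussian _))) {v : ℝ}
    (hv : ∫ z : EuclideanSpace ℝ (Fin d) × EuclideanSpace ℝ (Fin d), h z.1 z.2 ^ 2
      ∂((stdGaussian _).prod (stdGaussian _)) ≤ v) (r : Fin n → ℝ) :
    ∫ g : Fin n → EuclideanSpace ℝ (Fin d),
      (2 * ∑ p ∈ ltPairs n, (r p.1 * r p.2) * h (g p.1) (g p.2)) ^ 2
      ∂(Measure.pi fun _ => stdGaussian _) ≤ 2 * v * (∑ i, r i ^ 2) ^ 2 := by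
  have hγ : MeasurePreserving (fun x : EuclideanSpace ℝ (Fin d) => -x)
      (stdGaussian _) (stdGaussian _) := ⟨by fun_prop, stdGaussian_map_neg⟩
  have hv0 : 0 ≤ v := le_trans (integral_nonneg fun z => by positivity) hv
  simp_rw [mul_pow]
  rw [integral_const_mul, integral_sq_sum_ltPairs hγ h1 h2 hm hint]
  calc _ ≤ (2 : ℝ) ^ 2 * (v * ∑ p ∈ ltPairs n, (r p.1 * r p.2) ^ 2) := by
        gcongr
    _ = 2 * v * (2 * ∑ p ∈ ltPairs n, (r p.1 * r p.2) ^ 2) := by ring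
    _ ≤ _ := by gcongr; exact two_mul_sum_ltPairs_sq_le r

lemma memLp_offDiag_unitDirection (r : Fin n → ℝ) :
    MemLp (fun g : Fin n → EuclideanSpace ℝ (Fin d) => offDiag r fun i => unitDirection (g i)) 2
      (Measure.pi fun _ => stdGaussian _) :=
  (memLp_sum_pair (h := fun x y => ⟪unitDirection x, unitDirection y⟫)
    (by unfold Function.uncurry; fun_prop) integrable_inner_unitDirection_sq_prod _).const_mul 2

lemma integral_offDiag_unitDirection_sq_le (hd : 0 < d) (r : Fin n → ℝ) :
    ∫ g : Fin n → EuclideanSpace ℝ (Fin d), (offDiag r fun i => unitDirection (g i)) ^ 2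
      ∂(Measure.pi fun _ => stdGaussian _) ≤ 2 / d * (∑ i, r i ^ 2) ^ 2 := by
  have := integral_sq_sum_pair_le (n := n) (h := fun x y => ⟪unitDirection x, unitDirection y⟫)
    (by simp [unitDirection_neg]) (by simp [unitDirection_neg])
    (by unfold Function.uncurry; fun_prop) integrable_inner_unitDirection_sq_prod
    (integral_inner_unitDirection_sq_prod hd).le r
  rwa [mul_one_div] at this

lemma offDiag_unitDirection_sub (r : Fin n → ℝ) (g : Fin n → EuclideanSpace ℝ (Fin d)) :
    (offDiag r fun i => unitDirection (g i)) - offDiag r g / d =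
    2 * ∑ p ∈ ltPairs n, (r p.1 * r p.2) *
      (⟪unitDirection (g p.1), unitDirection (g p.2)⟫ - ⟪g p.1, g p.2⟫ / d) := by
  simp only [offDiag, mul_sub, Finset.sum_sub_distrib, Finset.mul_sum, Finset.sum_div]
  congr 1
  refine Finset.sum_congr rfl fun p _ => by ring

lemma memLp_offDiag_unitDirection_sub (r : Fin n → ℝ) :
    MemLp (fun g : Fin n → EuclideanSpace ℝ (Fin d) =>
      (offDiag r fun i => unitDirection (g i)) - offDiag r g / d) 2
      (Measure.pi fun _ => stdGaussian _) := by
  simp_rw [offDiag_unitDirection_sub]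
  exact (memLp_sum_pair (h := fun x y => ⟪unitDirection x, unitDirection y⟫ - ⟪x, y⟫ / d)
    (by unfold Function.uncurry; fun_prop) integrable_inner_unitDirection_sub_sq_prod _).const_mul 2

lemma integral_offDiag_unitDirection_sub_sq_le (hd : 0 < d) (r : Fin n → ℝ) :
    ∫ g : Fin n → EuclideanSpace ℝ (Fin d),
      ((offDiag r fun i => unitDirection (g i)) - offDiag r g / d) ^ 2
      ∂(Measure.pi fun _ => stdGaussian _) ≤ 8 / d ^ 2 * (∑ i, r i ^ 2) ^ 2 := by
  simp_rw [offDiag_unitDirection_sub]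
  have := integral_sq_sum_pair_le (n := n)
    (h := fun x y => ⟪unitDirection x, unitDirection y⟫ - ⟪x, y⟫ / d)
    (fun x y => by simp [unitDirection_neg]; ring) (fun x y => by simp [unitDirection_neg]; ring)
    (by unfold Function.uncurry; fun_prop) integrable_inner_unitDirection_sub_sq_prod
    (integral_inner_unitDirection_sub_sq_prod_le hd) r
  refine this.trans_eq ?_
  ring

lemma memLp_sum_mul_norm_sq_sub (r : Fin n → ℝ) :
    MemLp (fun g : Fin n → EuclideanSpace ℝ (Fin d) => ∑ i, r i ^ 2 * (‖g i‖ ^ 2 - d)) 2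
      (Measure.pi fun _ => stdGaussian _) := by
  refine memLp_finsetSum _ fun i _ => MemLp.const_mul ?_ _
  exact (memLp_norm_sq_stdGaussian.sub (memLp_const (d : ℝ))).comp_measurePreserving
    (measurePreserving_eval (fun _ : Fin n => stdGaussian (EuclideanSpace ℝ (Fin d))) i)

lemma integral_sum_mul_norm_sq_sub_sq (r : Fin n → ℝ) :
    ∫ g : Fin n → EuclideanSpace ℝ (Fin d), (∑ i, r i ^ 2 * (‖g i‖ ^ 2 - d)) ^ 2
      ∂(Measure.pi fun _ => stdGaussian _) = 2 * d * ∑ i, r i ^ 4 := by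
  have hL : ∀ i, MemLp (fun x : EuclideanSpace ℝ (Fin d) => r i ^ 2 * (‖x‖ ^ 2 - d)) 2
      (stdGaussian _) := fun i => (memLp_norm_sq_stdGaussian.sub (memLp_const (d : ℝ))).const_mul _
  have hz : ∀ i, ∫ x : EuclideanSpace ℝ (Fin d), r i ^ 2 * (‖x‖ ^ 2 - d) ∂(stdGaussian _) = 0 := by
    intro i
    rw [integral_const_mul, integral_sub integrable_norm_sq_stdGaussian (integrable_const _),
      integral_norm_sq_stdGaussian]
    simp
  have hv := variance_sum_pi hL
  have hf : (∑ i, fun g : Fin n → EuclideanSpace ℝ (Fin d) => r i ^ 2 * (‖g i‖ ^ 2 - d)) =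
      fun g => ∑ i, r i ^ 2 * (‖g i‖ ^ 2 - d) := by ext g; simp
  rw [hf, variance_eq_sub (memLp_sum_mul_norm_sq_sub r)] at hv
  have h0 : ∫ g : Fin n → EuclideanSpace ℝ (Fin d), ∑ i, r i ^ 2 * (‖g i‖ ^ 2 - d)
      ∂(Measure.pi fun _ => stdGaussian _) = 0 := by
    rw [integral_finsetSum _ fun i _ => ?_]
    · refine Finset.sum_eq_zero fun i _ => ?_
      rw [integral_comp_eval (μ := fun _ : Fin n => stdGaussian (EuclideanSpace ℝ (Fin d)))
        (f := fun x => r i ^ 2 * (‖x‖ ^ 2 - d)) (by fun_prop), hz]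
    · exact integrable_comp_eval (μ := fun _ : Fin n => stdGaussian (EuclideanSpace ℝ (Fin d)))
        (f := fun x => r i ^ 2 * (‖x‖ ^ 2 - d)) ((hL i).integrable (by norm_num))
  rw [h0] at hv
  simp only [Pi.pow_apply] at hv
  rw [zero_pow (by norm_num), sub_zero] at hv
  rw [hv, Finset.mul_sum]
  refine Finset.sum_congr rfl fun i _ => ?_
  rw [variance_const_mul, variance_sub_const (by fun_prop), variance_norm_sq_stdGaussian]
  ring

/-- A weighted sum of independent standard Gaussian vectors is a multiple of one. -/
lemma map_sum_smul_stdGaussian (r : Fin n → ℝ) :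
    (Measure.pi fun _ : Fin n => stdGaussian (EuclideanSpace ℝ (Fin d))).map
      (fun g => ∑ i, r i • g i) =
    (stdGaussian (EuclideanSpace ℝ (Fin d))).map (fun x => √(∑ i, r i ^ 2) • x) := by
  have hm1 : Measurable fun g : Fin n → EuclideanSpace ℝ (Fin d) => ∑ i, r i • g i := by fun_prop
  have hm2 : Measurable fun x : EuclideanSpace ℝ (Fin d) => √(∑ i, r i ^ 2) • x := by fun_prop
  have := Measure.isProbabilityMeasure_map (μ := Measure.pi fun _ : Fin n =>
    stdGaussian (EuclideanSpace ℝ (Fin d))) hm1.aemeasurable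
  have := Measure.isProbabilityMeasure_map (μ := stdGaussian (EuclideanSpace ℝ (Fin d)))
    hm2.aemeasurable
  refine Measure.ext_of_charFun ?_
  ext t
  rw [charFun_map_smul, charFun_stdGaussian, charFun_apply, integral_map hm1.aemeasurable
    (by fun_prop)]
  simp_rw [sum_inner, Complex.ofReal_sum, Finset.sum_mul, Complex.exp_sum]
  rw [integral_fintype_prod_eq_prod (f := fun i (x : EuclideanSpace ℝ (Fin d)) =>
    Complex.exp (⟪r i • x, t⟫ * Complex.I))]
  have h1 : ∀ i, ∫ x : EuclideanSpace ℝ (Fin d), Complex.exp (⟪r i • x, t⟫ * Complex.I)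
      ∂(stdGaussian _) = Complex.exp (-‖r i • t‖ ^ 2 / 2) := by
    intro i
    rw [← charFun_stdGaussian, charFun_apply]
    simp_rw [real_inner_smul_left, real_inner_smul_right]
  simp_rw [h1]
  rw [← Complex.exp_sum]
  congr 1
  simp only [norm_smul, Complex.ofReal_mul, mul_pow, Real.norm_eq_abs]
  simp only [← Complex.ofReal_pow, sq_abs]
  rw [Real.sq_sqrt (Finset.sum_nonneg fun i _ => sq_nonneg _), Complex.ofReal_sum, Finset.sum_mul,
    ← Finset.sum_neg_distrib, Finset.sum_div]

end FixedWeights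

/-! ### Conditional characteristic functions and the chi-square limit. -/

section FixedWeightsCharFun

variable {d n : ℕ}

lemma measurable_offDiag_unitDirection (r : Fin n → ℝ) :
    Measurable fun g : Fin n → EuclideanSpace ℝ (Fin d) =>
      offDiag r (fun i => unitDirection (g i)) := by
  have h : Measurable fun (g : Fin n → EuclideanSpace ℝ (Fin d)) (i : Fin n) =>
      unitDirection (g i) := by fun_prop
  exact (measurable_offDiag_right r).comp h

/-- Comparison with the constant `0`; this makes the off-diagonal part negligible in the stable
regime. -/
lemma norm_integral_cexp_offDiag_sub_one_le (hd : 0 < d) (r : Fin n → ℝ) (a t : ℝ) :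
    ‖∫ g : Fin n → EuclideanSpace ℝ (Fin d),
        Complex.exp (Complex.I * (t * (offDiag r (fun i => unitDirection (g i)) / a) : ℝ))
        ∂(Measure.pi fun _ => stdGaussian _) - 1‖ ≤
      |t| * √(2 / d * (∑ i, r i ^ 2) ^ 2 / a ^ 2) := by
  have hm : Measurable fun g : Fin n → EuclideanSpace ℝ (Fin d) =>
      offDiag r (fun i => unitDirection (g i)) / a :=
    (measurable_offDiag_unitDirection r).div_const a
  have hL : MemLp (fun g : Fin n → EuclideanSpace ℝ (Fin d) =>
      offDiag r (fun i => unitDirection (g i)) / a - (0 : ℝ)) 2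
      (Measure.pi fun _ => stdGaussian _) := by
    refine ((memLp_offDiag_unitDirection (d := d) r).const_mul a⁻¹).congr_norm
      (hm.sub_const 0).aestronglyMeasurable (ae_of_all _ fun g => ?_)
    rw [sub_zero, div_eq_inv_mul]
  have h := norm_integral_cexp_sub_le hm (measurable_const (a := (0 : ℝ))) hL t
  simp only [mul_zero, Complex.ofReal_zero, Complex.exp_zero, integral_const, probReal_univ,
    one_smul, sub_zero, div_pow, integral_div] at h
  refine h.trans ?_
  gcongr
  exact integral_offDiag_unitDirection_sq_le hd r

/-- The three error terms come from replacing directions by Gaussian vectors over `√d`, from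
replacing the random diagonal `∑ r_i² ‖g_i‖²` by its mean `d ∑ r_i²`, and from replacing `∑ r_i²` by
`n`. -/
lemma norm_integral_cexp_offDiag_sub_le (hd : 0 < d) (hn : 0 < n) (r : Fin n → ℝ) (t : ℝ) :
    ‖∫ g : Fin n → EuclideanSpace ℝ (Fin d), Complex.exp (Complex.I *
        (t * (offDiag r (fun i => unitDirection (g i)) / √(2 * (n : ℝ) ^ 2 / d)) : ℝ))
        ∂(Measure.pi fun _ => stdGaussian _) -
      ∫ x : EuclideanSpace ℝ (Fin d), Complex.exp (Complex.I *
        (t * ((‖x‖ ^ 2 - d) / √(2 * d)) : ℝ)) ∂(stdGaussian _)‖ ≤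
      |t| * √(4 * ((∑ i, r i ^ 2) / n) ^ 2 / d) + |t| * √((∑ i, r i ^ 4) / n ^ 2) +
        |t| * √(((∑ i, r i ^ 2) / n - 1) ^ 2) := by
  have hd' : (0 : ℝ) < d := by exact_mod_cast hd
  have hn' : (0 : ℝ) < n := by exact_mod_cast hn
  set T := ∑ i, r i ^ 2 with hT
  set a := √(2 * (n : ℝ) ^ 2 / d) with ha
  have ha0 : 0 < a := by positivity
  have ha2 : a ^ 2 = 2 * (n : ℝ) ^ 2 / d := Real.sq_sqrt (by positivity)
  set G := Measure.pi fun _ : Fin n => stdGaussian (EuclideanSpace ℝ (Fin d)) with hG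
  have hm1 : Measurable fun g : Fin n → EuclideanSpace ℝ (Fin d) =>
      offDiag r (fun i => unitDirection (g i)) / a :=
    (measurable_offDiag_unitDirection r).div_const a
  have hm2 : Measurable fun g : Fin n → EuclideanSpace ℝ (Fin d) => offDiag r g / d / a :=
    ((measurable_offDiag_right r).div_const _).div_const a
  have hms : Measurable fun g : Fin n → EuclideanSpace ℝ (Fin d) => ∑ i, r i • g i := by fun_prop
  have hm3 : Measurable fun g : Fin n → EuclideanSpace ℝ (Fin d) =>
      (‖∑ i, r i • g i‖ ^ 2 - d * T) / d / a := by fun_prop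
  have e1 : ∀ g : Fin n → EuclideanSpace ℝ (Fin d),
      offDiag r (fun i => unitDirection (g i)) / a - offDiag r g / d / a =
      a⁻¹ * (offDiag r (fun i => unitDirection (g i)) - offDiag r g / d) := fun g => by ring
  have e2 : ∀ g : Fin n → EuclideanSpace ℝ (Fin d),
      offDiag r g / d / a - (‖∑ i, r i • g i‖ ^ 2 - d * T) / d / a =
      -(d * a)⁻¹ * ∑ i, r i ^ 2 * (‖g i‖ ^ 2 - d) := fun g => by
    rw [norm_sq_sum_smul_eq, hT]
    simp only [mul_sub, Finset.sum_sub_distrib, ← Finset.sum_mul, offDiag]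
    field_simp
    ring
  have e3 : ∀ x : EuclideanSpace ℝ (Fin d),
      T * (‖x‖ ^ 2 - d) / d / a - (‖x‖ ^ 2 - d) / √(2 * d) =
      (T / (d * a) - 1 / √(2 * d)) * (‖x‖ ^ 2 - d) := fun x => by
    field_simp
  have b1 := norm_integral_cexp_sub_le (μ := G) hm1 hm2
    (by simp_rw [e1]; exact (memLp_offDiag_unitDirection_sub r).const_mul _) t
  have b2 := norm_integral_cexp_sub_le (μ := G) hm2 hm3
    (by simp_rw [e2]; exact (memLp_sum_mul_norm_sq_sub r).const_mul _) t
  have hc : MemLp (fun x : EuclideanSpace ℝ (Fin d) => ‖x‖ ^ 2 - d) 2 (stdGaussian _) :=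
    memLp_norm_sq_stdGaussian.sub (memLp_const (d : ℝ))
  have b3 := norm_integral_cexp_sub_le (μ := stdGaussian (EuclideanSpace ℝ (Fin d)))
    (X := fun x => T * (‖x‖ ^ 2 - d) / d / a) (Y := fun x => (‖x‖ ^ 2 - d) / √(2 * d))
    (by fun_prop) (by fun_prop) (by simp_rw [e3]; exact hc.const_mul _) t
  -- No error here: `∑ r_i g_i` has exactly the law of `√T` times a standard Gaussian vector.
  have hlaw : ∫ g, Complex.exp (Complex.I * (t * ((‖∑ i, r i • g i‖ ^ 2 - d * T) / d / a) : ℝ)) ∂G =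
      ∫ x : EuclideanSpace ℝ (Fin d), Complex.exp (Complex.I *
        (t * (T * (‖x‖ ^ 2 - d) / d / a) : ℝ)) ∂(stdGaussian _) := by
    have i1 := integral_map (μ := G) hms.aemeasurable (f := fun y : EuclideanSpace ℝ (Fin d) =>
      Complex.exp (Complex.I * (t * ((‖y‖ ^ 2 - d * T) / d / a) : ℝ))) (by fun_prop)
    rw [← i1, hG, map_sum_smul_stdGaussian, integral_map (by fun_prop) (by fun_prop)]
    simp only [norm_smul, mul_pow, Real.norm_eq_abs, sq_abs]
    rw [Real.sq_sqrt (Finset.sum_nonneg fun i _ => sq_nonneg _), ← hT]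
    simp only [show ∀ x : EuclideanSpace ℝ (Fin d), T * ‖x‖ ^ 2 - d * T = T * (‖x‖ ^ 2 - d) from
      fun x => by ring]
  rw [hlaw] at b2
  have c1 : ∫ g, (offDiag r (fun i => unitDirection (g i)) / a - offDiag r g / d / a) ^ 2 ∂G ≤
      4 * (T / n) ^ 2 / d := by
    simp_rw [e1, mul_pow]
    rw [integral_const_mul]
    calc _ ≤ a⁻¹ ^ 2 * (8 / d ^ 2 * T ^ 2) := by
          gcongr; exact integral_offDiag_unitDirection_sub_sq_le hd r
      _ = _ := by rw [inv_pow, ha2]; field_simp; ring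
  have c2 : ∫ g, (offDiag r g / d / a - (‖∑ i, r i • g i‖ ^ 2 - d * T) / d / a) ^ 2 ∂G =
      (∑ i, r i ^ 4) / n ^ 2 := by
    simp_rw [e2, mul_pow]
    rw [integral_const_mul, integral_sum_mul_norm_sq_sub_sq, neg_sq, inv_pow, mul_pow, ha2]
    field_simp
  have c3 : ∫ x : EuclideanSpace ℝ (Fin d),
      (T * (‖x‖ ^ 2 - d) / d / a - (‖x‖ ^ 2 - d) / √(2 * d)) ^ 2 ∂(stdGaussian _) =
      (T / n - 1) ^ 2 := by
    have hv := variance_norm_sq_stdGaussian (d := d)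
    rw [variance_eq_integral (by fun_prop), integral_norm_sq_stdGaussian] at hv
    simp_rw [e3, mul_pow]
    rw [integral_const_mul, hv]
    have h2 : a * √(2 * d) = 2 * n := by
      rw [ha, ← Real.sqrt_mul (by positivity),
        show 2 * (n : ℝ) ^ 2 / d * (2 * d) = (2 * n) ^ 2 by field_simp,
        Real.sqrt_sq (by positivity)]
    have h3 : √(2 * (d : ℝ)) ^ 2 = 2 * d := Real.sq_sqrt (by positivity)
    have h4 : 1 / √(2 * (d : ℝ)) = √(2 * d) / (2 * d) := by
      rw [div_eq_div_iff (by positivity) (by positivity), one_mul, ← sq, h3]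
    have h5 : 1 / a = √(2 * d) / (2 * n) := by
      rw [div_eq_div_iff (by positivity) (by positivity)]; linarith
    have h6 : T / (d * a) - 1 / √(2 * d) = √(2 * d) / (2 * d) * (T / n - 1) := by
      rw [h4, show T / (d * a) = T / d * (1 / a) by field_simp, h5]
      field_simp
    rw [h6, mul_pow, div_pow, h3]
    field_simp
  rw [c2] at b2
  rw [c3] at b3
  have b1' : |t| * √(∫ g, (offDiag r (fun i => unitDirection (g i)) / a -
      offDiag r g / d / a) ^ 2 ∂G) ≤ |t| * √(4 * (T / n) ^ 2 / d) := by gcongr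
  have := norm_sub_le_norm_sub_add_norm_sub
    (∫ g : Fin n → EuclideanSpace ℝ (Fin d), Complex.exp (Complex.I *
        (t * (offDiag r (fun i => unitDirection (g i)) / a) : ℝ)) ∂G)
    (∫ g, Complex.exp (Complex.I * (t * (offDiag r g / d / a) : ℝ)) ∂G)
    (∫ x : EuclideanSpace ℝ (Fin d), Complex.exp (Complex.I *
        (t * ((‖x‖ ^ 2 - d) / √(2 * d)) : ℝ)) ∂(stdGaussian _))
  have := norm_sub_le_norm_sub_add_norm_sub
    (∫ g, Complex.exp (Complex.I * (t * (offDiag r g / d / a) : ℝ)) ∂G)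
    (∫ x : EuclideanSpace ℝ (Fin d), Complex.exp (Complex.I *
        (t * (T * (‖x‖ ^ 2 - d) / d / a) : ℝ)) ∂(stdGaussian _))
    (∫ x : EuclideanSpace ℝ (Fin d), Complex.exp (Complex.I *
        (t * ((‖x‖ ^ 2 - d) / √(2 * d)) : ℝ)) ∂(stdGaussian _))
  linarith

/-- Central limit theorem for the chi-square distribution. -/
lemma tendsto_integral_cexp_norm_sq_stdGaussian (t : ℝ) :
    Tendsto (fun d : ℕ => ∫ x : EuclideanSpace ℝ (Fin d), Complex.exp (Complex.I *
        (t * ((‖x‖ ^ 2 - d) / √(2 * d)) : ℝ)) ∂(stdGaussian _)) atTop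
      (𝓝 (Complex.exp (-t ^ 2 / 2))) := by
  have hm : MemLp (fun x : ℝ => x ^ 2) 2 (gaussianReal 0 1) := by
    rw [memLp_two_iff_integrable_sq (by fun_prop)]
    refine (integrable_pow_gaussianReal 4).congr (ae_of_all _ fun x => ?_)
    ring
  have h0 : ∫ x, (x ^ 2 - 1) / √2 ∂(gaussianReal 0 1) = 0 := by
    rw [integral_div, integral_sub (hm.integrable (by norm_num)) (integrable_const _),
      integral_sq_gaussianReal]
    simp
  have h1 : ∫ x, ((fun x : ℝ => (x ^ 2 - 1) / √2) ^ 2) x ∂(gaussianReal 0 1) = 1 := by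
    have hv := variance_sq_gaussianReal
    rw [variance_eq_integral (by fun_prop), integral_sq_gaussianReal] at hv
    simp only [Pi.pow_apply, div_pow]
    rw [integral_div, hv, Real.sq_sqrt (by norm_num), div_self (by norm_num)]
  -- The squared norm is a sum of `d` independent squared coordinates of mean `1` and variance `2`,
  -- so its characteristic function is a `d`-th power.
  have key := tendsto_charFun_inv_sqrt_mul_pow (P := gaussianReal 0 1)
    (X := fun x : ℝ => (x ^ 2 - 1) / √2) (by fun_prop) h0 h1 t
  refine key.congr fun d => ?_
  rw [stdGaussian_integral_comp _ (by fun_prop), charFun_apply_real,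
    integral_map (by fun_prop) (by fun_prop)]
  have h2 : ∀ y : Fin d → ℝ, Complex.exp (Complex.I *
      (t * ((‖WithLp.toLp 2 y‖ ^ 2 - d) / √(2 * d)) : ℝ)) =
      ∏ i, Complex.exp (((√d)⁻¹ * t : ℝ) * ((y i ^ 2 - 1) / √2 : ℝ) * Complex.I) := by
    intro y
    rw [← Complex.exp_sum, ← Finset.sum_mul, ← Finset.mul_sum, mul_comm Complex.I]
    congr 2
    rw [EuclideanSpace.real_norm_sq_eq]
    simp only [← Complex.ofReal_sum, ← Complex.ofReal_mul]
    congr 1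
    rw [← Finset.sum_div, Finset.sum_sub_distrib, Real.sqrt_mul (by norm_num)]
    simp
    ring
  simp_rw [h2]
  rw [integral_fintype_prod_eq_pow (fun x : ℝ =>
    Complex.exp (((√d)⁻¹ * t : ℝ) * ((x ^ 2 - 1) / √2 : ℝ) * Complex.I))]
  simp

end FixedWeightsCharFun

/-! ### Deterministic and distributional convergence tools. -/

/-- Converging averages force `b n / n → 0`, hence the maximum of the first `n` terms is `o(n)`; the
sum of squares is at most this maximum times the sum. Applied to `b i = R_i²`, it replaces a fourth
moment assumption. -/
lemma tendsto_sum_sq_div_sq_of_tendsto_sum_div {b : ℕ → ℝ} (hb : ∀ i, 0 ≤ b i) {c : ℝ}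
    (h : Tendsto (fun n : ℕ => (∑ i ∈ Finset.range n, b i) / n) atTop (𝓝 c)) :
    Tendsto (fun n : ℕ => (∑ i ∈ Finset.range n, b i ^ 2) / n ^ 2) atTop (𝓝 0) := by
  have h1 : Tendsto (fun n : ℕ => b n / n) atTop (𝓝 0) := by
    have hs := (tendsto_add_atTop_iff_nat 1).2 h
    have hr : Tendsto (fun n : ℕ => ((n + 1 : ℕ) : ℝ) / n) atTop (𝓝 1) := by
      have : Tendsto (fun n : ℕ => 1 + 1 / (n : ℝ)) atTop (𝓝 (1 + 0)) :=
        tendsto_const_nhds.add tendsto_one_div_atTop_nhds_zero_nat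
      rw [add_zero] at this
      refine this.congr' ?_
      filter_upwards [eventually_gt_atTop 0] with n hn
      have : (n : ℝ) ≠ 0 := by positivity
      field_simp; push_cast; ring
    have := (hs.mul hr).sub h
    rw [mul_one, sub_self] at this
    refine this.congr' ?_
    filter_upwards [eventually_gt_atTop 0] with n hn
    have : (n : ℝ) ≠ 0 := by positivity
    have h2 : ((n + 1 : ℕ) : ℝ) ≠ 0 := by positivity
    rw [Finset.sum_range_succ]
    field_simp; ring
  have hT : ∀ᶠ n : ℕ in atTop, (∑ i ∈ Finset.range n, b i) / n ≤ |c| + 1 :=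
    h.eventually_le_const (by linarith [le_abs_self c])
  rw [Metric.tendsto_nhds]
  intro ε hε
  -- The final bound is `2δ(|c| + 1) = 2ε/3 < ε`.
  set δ := ε / (3 * (|c| + 1)) with hδ
  have hc : 0 < |c| + 1 := by positivity
  have hδ0 : 0 < δ := by positivity
  obtain ⟨N, hN⟩ := eventually_atTop.1 ((h1.eventually (gt_mem_nhds hδ0)).and
    (eventually_gt_atTop 0))
  set K := ∑ i ∈ Finset.range N, b i
  have hK : 0 ≤ K := Finset.sum_nonneg fun i _ => hb i
  have hK2 : Tendsto (fun n : ℕ => K / (n : ℝ)) atTop (𝓝 0) := tendsto_const_div_atTop_nhds_zero_nat K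
  filter_upwards [hT, eventually_gt_atTop 0, hK2.eventually (gt_mem_nhds hδ0)] with n hTn hn hKn
  have hn' : (0 : ℝ) < n := by exact_mod_cast hn
  have hbi : ∀ i ∈ Finset.range n, b i ≤ 2 * δ * n := by
    intro i hi
    rw [div_lt_iff₀ hn'] at hKn
    have hin : (i : ℝ) ≤ n := by exact_mod_cast (Finset.mem_range.1 hi).le
    rcases lt_or_ge i N with hiN | hiN
    · have : b i ≤ K := Finset.single_le_sum (fun j _ => hb j) (Finset.mem_range.2 hiN)
      nlinarith
    · obtain ⟨h3, hi0⟩ := hN i hiN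
      have hi0' : (0 : ℝ) < i := by exact_mod_cast hi0
      rw [div_lt_iff₀ hi0'] at h3
      nlinarith
  rw [Real.dist_eq, sub_zero, abs_of_nonneg (div_nonneg (Finset.sum_nonneg fun i _ => sq_nonneg _)
    (sq_nonneg _)), div_lt_iff₀ (by positivity)]
  rw [div_le_iff₀ hn'] at hTn
  calc ∑ i ∈ Finset.range n, b i ^ 2 ≤ ∑ i ∈ Finset.range n, 2 * δ * n * b i := by
        refine Finset.sum_le_sum fun i hi => ?_
        rw [sq]; exact mul_le_mul_of_nonneg_right (hbi i hi) (hb i)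
    _ = 2 * δ * n * ∑ i ∈ Finset.range n, b i := by rw [Finset.mul_sum]
    _ ≤ 2 * δ * n * ((|c| + 1) * n) := by gcongr
    _ = 2 * (ε / 3) * n ^ 2 := by rw [hδ]; field_simp
    _ < ε * n ^ 2 := by
        have : 0 < (n : ℝ) ^ 2 := by positivity
        nlinarith

lemma map_pi_unitDirection {d : ℕ} (hd : 0 < d) (n : ℕ) :
    (Measure.pi fun _ : Fin n => stdGaussian (EuclideanSpace ℝ (Fin d))).map
      (fun g i => unitDirection (g i)) = Measure.pi fun _ : Fin n => uniformUnitSphere d := by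
  have := isProbabilityMeasure_uniformUnitSphere hd
  exact (measurePreserving_pi (fun _ : Fin n => stdGaussian (EuclideanSpace ℝ (Fin d)))
    (fun _ => uniformUnitSphere d) (f := fun _ => unitDirection) fun _ =>
      ⟨measurable_unitDirection, stdGaussian_map_unitDirection hd⟩).map_eq

/-- Portmanteau for the closed set `{ε ≤ ‖x‖}`, which the zero limit does not charge. -/
lemma tendstoInMeasure_of_tendstoInDistribution_zero {Ω Ω' : Type*} [MeasurableSpace Ω]
    [MeasurableSpace Ω'] {P : Measure Ω} [IsProbabilityMeasure P] {P' : Measure Ω'}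
    [IsProbabilityMeasure P'] {X : ℕ → Ω → ℝ} {Z : Ω' → ℝ} (hZ : ∀ ω, Z ω = 0)
    (h : TendstoInDistribution X atTop Z (fun _ => P) P') :
    TendstoInMeasure P X atTop 0 := by
  rw [tendstoInMeasure_iff_norm]
  intro ε hε
  have hF : IsClosed {x : ℝ | ε ≤ ‖x‖} := isClosed_le continuous_const continuous_norm
  have h1 := ProbabilityMeasure.limsup_measure_closed_le_of_tendsto h.tendsto hF
  simp only [ProbabilityMeasure.coe_mk] at h1
  rw [Measure.map_apply_of_aemeasurable h.aemeasurable_limit hF.measurableSet] at h1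
  have h2 : Z ⁻¹' {x : ℝ | ε ≤ ‖x‖} = ∅ := by
    ext ω; simp [hZ, hε]
  rw [h2, measure_empty] at h1
  have h3 : ∀ i, P.map (X i) {x : ℝ | ε ≤ ‖x‖} = P {x | ε ≤ ‖X i x - (0 : Ω → ℝ) x‖} := fun i => by
    rw [Measure.map_apply_of_aemeasurable (h.forall_aemeasurable i) hF.measurableSet]
    simp
  simp_rw [h3] at h1
  exact tendsto_of_le_liminf_of_limsup_le bot_le h1

lemma tendstoInDistribution_of_tendsto_integral_cexp {Ω Ω' : Type*} [MeasurableSpace Ω]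
    [MeasurableSpace Ω'] {P : Measure Ω} [IsProbabilityMeasure P] {P' : Measure Ω'}
    [IsProbabilityMeasure P'] {X : ℕ → Ω → ℝ} {Z : Ω' → ℝ} (hX : ∀ i, Measurable (X i))
    (hZ : Measurable Z)
    (h : ∀ t : ℝ, Tendsto (fun i => ∫ ω, Complex.exp (Complex.I * (t * X i ω : ℝ)) ∂P) atTop
      (𝓝 (charFun (P'.map Z) t))) :
    TendstoInDistribution X atTop Z (fun _ => P) P' where
  forall_aemeasurable i := (hX i).aemeasurable
  aemeasurable_limit := hZ.aemeasurable
  tendsto := by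
    refine ProbabilityMeasure.tendsto_iff_tendsto_charFun.2 fun t => ?_
    refine (h t).congr fun i => ?_
    simp only [ProbabilityMeasure.coe_mk]
    rw [charFun_apply_real, integral_map (hX i).aemeasurable (by fun_prop)]
    congr 1; ext ω
    congr 1; push_cast; ring

/-! ### Strong law for the radii and conditioning on them. -/

section Model

variable {Ω : Type*} [MeasurableSpace Ω] {P : Measure Ω}
  {R : ℕ → Ω → ℝ} {U : (d : ℕ) → ℕ → Ω → EuclideanSpace ℝ (Fin d)}

namespace IsRotationInvariantModel

lemma ae_tendsto_sum_sq_div (hM : IsRotationInvariantModel P R U) :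
    ∀ᵐ ω ∂P, Tendsto (fun n : ℕ => (∑ i ∈ Finset.range n, R i ω ^ 2) / n) atTop (𝓝 1) := by
  -- The integral of a non-integrable function is `0` by convention, so the value `1` forces
  -- integrability.
  have hi : Integrable (fun ω => R 0 ω ^ 2) P := by
    by_contra h
    have := hM.radial_second_moment
    rw [integral_undef h] at this
    norm_num at this
  have h := strong_law_ae_real (μ := P) (fun i ω => R i ω ^ 2) hi
    (fun i j hij => (hM.radial_iIndep.indepFun hij).comp (φ := fun x => x ^ 2)
      (ψ := fun x => x ^ 2) (by fun_prop) (by fun_prop))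
    (fun i => (hM.radial_identDistrib i).comp (u := fun x => x ^ 2) (by fun_prop))
  rw [hM.radial_second_moment] at h
  exact h

variable [IsProbabilityMeasure P]

/-- Fubini over the independent radii and directions, with the directions realised as normalised
Gaussian vectors. -/
lemma integral_comp_eq (hM : IsRotationInvariantModel P R U) {d : ℕ} (hd : 0 < d) (n : ℕ)
    {F : (Fin n → ℝ) × (Fin n → EuclideanSpace ℝ (Fin d)) → ℂ} (hF : Measurable F) {C : ℝ}
    (hC : ∀ z, ‖F z‖ ≤ C) :
    ∫ ω, F (fun i => R i ω, fun i => U d i ω) ∂P =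
      ∫ ω, ∫ g, F (fun i => R i ω, fun i => unitDirection (g i))
        ∂(Measure.pi fun _ : Fin n => stdGaussian (EuclideanSpace ℝ (Fin d))) ∂P := by
  have := isProbabilityMeasure_uniformUnitSphere hd
  have hR : Measurable fun ω (i : Fin n) => R i ω :=
    measurable_pi_lambda _ fun i => hM.measurable_radial i
  have hU : Measurable fun ω (i : Fin n) => U d i ω :=
    measurable_pi_lambda _ fun i => hM.measurable_direction d hd i
  have hi : IndepFun (fun ω (i : Fin n) => R i ω) (fun ω (i : Fin n) => U d i ω) P :=
    (hM.radial_indep_direction d hd).comp (φ := fun (x : ℕ → ℝ) (i : Fin n) => x i)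
      (ψ := fun (x : ℕ → EuclideanSpace ℝ (Fin d)) (i : Fin n) => x i) (by fun_prop) (by fun_prop)
  have hlaw : P.map (fun ω (i : Fin n) => U d i ω) =
      Measure.pi fun _ : Fin n => uniformUnitSphere d := by
    have h : iIndepFun (fun i : Fin n => U d i) P :=
      (hM.direction_iIndep d hd).precomp (g := fun i : Fin n => (i : ℕ)) Fin.val_injective
    have h' := (iIndepFun_iff_map_fun_eq_pi_map (ι := Fin n)
      fun i => (hM.measurable_direction d hd i).aemeasurable).1 h
    simp_rw [h', hM.direction_uniform d hd]
  rw [indepFun_iff_map_prod_eq_prod_map_map hR.aemeasurable hU.aemeasurable] at hi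
  have := Measure.isProbabilityMeasure_map (μ := P) hR.aemeasurable
  have hFi : Integrable F ((P.map fun ω (i : Fin n) => R i ω).prod
      (Measure.pi fun _ : Fin n => uniformUnitSphere d)) :=
    Integrable.of_bound hF.aestronglyMeasurable C (ae_of_all _ hC)
  have h1 := integral_map (μ := P) (hR.prodMk hU).aemeasurable (f := F) hF.aestronglyMeasurable
  rw [← h1, hi, hlaw, integral_prod _ hFi,
    integral_map hR.aemeasurable hFi.integral_prod_left.aestronglyMeasurable]
  congr 1; ext ω
  rw [← map_pi_unitDirection hd, integral_map (Measurable.aemeasurable (by fun_prop))]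
  exact (hF.comp (by fun_prop)).aestronglyMeasurable

/-- The quenched limit: convergence of the conditional characteristic functions given the radial
parts implies convergence of the characteristic functions. -/
lemma tendsto_integral_cexp_offDiag (hM : IsRotationInvariantModel P R U) (n : ℕ → ℕ) (a : ℕ → ℝ)
    (t : ℝ) {c : ℂ}
    (h : ∀ᵐ ω ∂P, Tendsto (fun d => ∫ g, Complex.exp (Complex.I *
        (t * (offDiag (fun i : Fin (n d) => R i ω) (fun i => unitDirection (g i)) / a d) : ℝ))
        ∂(Measure.pi fun _ : Fin (n d) => stdGaussian (EuclideanSpace ℝ (Fin d)))) atTop (𝓝 c)) :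
    Tendsto (fun d => ∫ ω, Complex.exp (Complex.I * (t * (offDiag (fun i : Fin (n d) => R i ω)
      (fun i => U d i ω) / a d) : ℝ)) ∂P) atTop (𝓝 c) := by
  have hF : ∀ d, Measurable fun z : (Fin (n d) → ℝ) × (Fin (n d) → EuclideanSpace ℝ (Fin d)) =>
      Complex.exp (Complex.I * (t * (offDiag z.1 z.2 / a d) : ℝ)) := by
    intro d
    have := (measurable_offDiag (E := EuclideanSpace ℝ (Fin d)) (n := n d)).div_const (a d)
    fun_prop
  have hb : ∀ x : ℝ, ‖Complex.exp (Complex.I * (x : ℝ))‖ = 1 := fun x => by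
    rw [mul_comm]; exact Complex.norm_exp_ofReal_mul_I x
  have hlim : Tendsto (fun d => ∫ ω, ∫ g, Complex.exp (Complex.I *
        (t * (offDiag (fun i : Fin (n d) => R i ω) (fun i => unitDirection (g i)) / a d) : ℝ))
        ∂(Measure.pi fun _ : Fin (n d) => stdGaussian (EuclideanSpace ℝ (Fin d))) ∂P) atTop
      (𝓝 (∫ _, c ∂P)) := by
    refine tendsto_integral_of_dominated_convergence (fun _ => 1) (fun d => ?_)
      (integrable_const _) (fun d => ae_of_all _ fun ω => ?_) h
    · have hR : Measurable fun ω (i : Fin (n d)) => R i ω :=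
        measurable_pi_lambda _ fun i => hM.measurable_radial i
      have hz : Measurable fun z : Ω × (Fin (n d) → EuclideanSpace ℝ (Fin d)) =>
          ((fun i : Fin (n d) => R i z.1, fun i => unitDirection (z.2 i)) :
            (Fin (n d) → ℝ) × (Fin (n d) → EuclideanSpace ℝ (Fin d))) :=
        (hR.comp measurable_fst).prodMk (by fun_prop)
      exact (((hF d).comp hz).stronglyMeasurable.integral_prod_right').aestronglyMeasurable
    · refine (norm_integral_le_of_norm_le_const (C := 1) (ae_of_all _ fun g => (hb _).le)).trans ?_
      simp
  rw [integral_const, probReal_univ, one_smul] at hlim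
  refine hlim.congr' ?_
  filter_upwards [eventually_gt_atTop 0] with d hd
  exact (hM.integral_comp_eq hd (n d) (hF d) (fun z => (hb _).le)).symm

end IsRotationInvariantModel

end Model

/-! ### Slowly varying functions and Potter bounds. -/

section SlowVariation

/-- Uniform convergence theorem, in additive form. -/
lemma exists_forall_abs_add_sub_le {f : ℝ → ℝ} (hf : Measurable f)
    (h : ∀ u, Tendsto (fun x => f (x + u) - f x) atTop (𝓝 0)) {ε : ℝ} (hε : 0 < ε) :
    ∃ X, ∀ x, X ≤ x → ∀ u ∈ Set.Icc (0 : ℝ) 1, |f (x + u) - f x| ≤ ε := by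
  by_contra! hcon
  choose x hx u hu hxu using fun k : ℕ => hcon k
  have hx' : Tendsto x atTop atTop := tendsto_atTop_mono hx tendsto_natCast_atTop_atTop
  have hxu' : Tendsto (fun k => x k + u k) atTop atTop :=
    tendsto_atTop_mono (fun k => by linarith [(hu k).1]) hx'
  -- Pointwise convergence on an interval of finite length implies convergence in measure.
  have hmeas : ∀ y : ℕ → ℝ, Tendsto y atTop atTop →
      ∀ᶠ k in atTop, volume {v ∈ Set.Icc (0 : ℝ) 2 | ε / 2 ≤ |f (y k + v) - f (y k)|} < 1 / 4 := by
    intro y hy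
    have h1 : TendstoInMeasure (volume.restrict (Set.Icc (0 : ℝ) 2))
        (fun k v => f (y k + v) - f (y k)) atTop (fun _ => (0 : ℝ)) := by
      refine tendstoInMeasure_of_tendsto_ae (fun k => ?_) (ae_of_all _ fun v => (h v).comp hy)
      exact ((hf.comp (measurable_const_add _)).sub_const _).aestronglyMeasurable
    rw [tendstoInMeasure_iff_norm] at h1
    filter_upwards [(h1 (ε / 2) (by positivity)).eventually_lt_const
      (show (0 : ℝ≥0∞) < 1 / 4 by simp)] with k hk
    rw [Measure.restrict_apply' measurableSet_Icc] at hk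
    convert hk using 2
    ext v
    simp [and_comm]
  obtain ⟨k, hk1, hk2⟩ := ((hmeas x hx').and (hmeas _ hxu')).exists
  set A := {v ∈ Set.Icc (0 : ℝ) 2 | ε / 2 ≤ |f (x k + v) - f (x k)|}
  set B := {v ∈ Set.Icc (0 : ℝ) 2 | ε / 2 ≤ |f (x k + u k + v) - f (x k + u k)|}
  -- At a point `v` outside both sets, `f (x k + v)` is within `ε / 2` of both `f (x k)` and `f (x k
  -- + u k)`, which differ by more than `ε`. So an interval of length `1` is covered by two sets of
  -- measure below `1 / 4`.
  have hsub : Set.Icc (1 : ℝ) 2 ⊆ A ∪ (fun v => v - u k) ⁻¹' B := by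
    intro v hv
    have hu1 := (hu k).1
    have hu2 := (hu k).2
    by_contra hnot
    simp only [Set.mem_union, Set.mem_preimage, A, B, Set.mem_ofPred_eq, Set.mem_Icc, not_or,
      not_and, not_le] at hnot
    have h1 := hnot.1 ⟨by linarith [hv.1], hv.2⟩
    have h2 := hnot.2 ⟨by linarith [hv.1], by linarith [hv.2]⟩
    rw [show x k + u k + (v - u k) = x k + v by ring] at h2
    have := hxu k
    have h3 : f (x k + u k) - f (x k) =
      (f (x k + v) - f (x k)) - (f (x k + v) - f (x k + u k)) := by ring
    rw [h3] at this
    have := abs_sub (f (x k + v) - f (x k)) (f (x k + v) - f (x k + u k))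
    linarith
  have hB : volume ((fun v => v - u k) ⁻¹' B) = volume B := by
    simp_rw [sub_eq_add_neg]
    exact measure_preimage_add_right volume _ _
  have hle : (1 : ℝ≥0∞) ≤ 1 / 4 + 1 / 4 := by
    calc (1 : ℝ≥0∞) = volume (Set.Icc (1 : ℝ) 2) := by
          rw [Real.volume_Icc]; norm_num
      _ ≤ volume A + volume ((fun v => v - u k) ⁻¹' B) :=
          (measure_mono hsub).trans (measure_union_le _ _)
      _ ≤ _ := by rw [hB]; exact add_le_add hk1.le hk2.le
  have h4 : (1 / 4 + 1 / 4 : ℝ≥0∞) = ENNReal.ofReal (1 / 2) := by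
    rw [show (1 / 2 : ℝ) = 1 / 4 + 1 / 4 by norm_num, ENNReal.ofReal_add (by norm_num)
      (by norm_num), ENNReal.ofReal_div_of_pos (by norm_num)]
    simp
  rw [h4, ← ENNReal.ofReal_one, ENNReal.ofReal_le_ofReal_iff (by norm_num)] at hle
  norm_num at hle

/-- Telescoping in unit steps gives growth with slope `η / 2`; the other half of the slope absorbs
the initial value. -/
lemma eventually_abs_le_mul_of_tendsto_add_sub {f : ℝ → ℝ} (hf : Measurable f)
    (h : ∀ u, Tendsto (fun x => f (x + u) - f x) atTop (𝓝 0)) {η : ℝ} (hη : 0 < η) :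
    ∀ᶠ x in atTop, |f x| ≤ η * x := by
  obtain ⟨X, hX⟩ := exists_forall_abs_add_sub_le hf h (half_pos hη)
  have hk : ∀ k : ℕ, |f (X + k) - f X| ≤ k * (η / 2) := by
    intro k
    induction k with
    | zero => simp
    | succ k ih =>
      have h1 := hX (X + k) (by linarith [Nat.cast_nonneg (α := ℝ) k]) 1 (by simp)
      have h2 := abs_add_le (f (X + k + 1) - f (X + k)) (f (X + k) - f X)
      rw [sub_add_sub_cancel] at h2
      push_cast
      rw [← add_assoc]
      linarith
  filter_upwards [eventually_ge_atTop X,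
    eventually_ge_atTop ((|f X| + (1 - X) * (η / 2)) / (η / 2))] with x hx1 hx2
  rw [div_le_iff₀ (by positivity)] at hx2
  have hfl := Nat.floor_le (sub_nonneg.2 hx1)
  have hfl2 := Nat.lt_floor_add_one (x - X)
  set k := ⌊x - X⌋₊
  have h1 := hX (X + k) (by linarith [Nat.cast_nonneg (α := ℝ) k]) (x - (X + k))
    ⟨by linarith, by linarith⟩
  rw [add_sub_cancel] at h1
  have h2 := hk k
  have h3 : |f x| ≤ |f x - f (X + k)| + |f (X + k) - f X| + |f X| := by
    have := abs_add_three (f x - f (X + k)) (f (X + k) - f X) (f X)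
    simpa using this
  nlinarith

/-- Potter-type bounds for slowly varying functions. -/
lemma IsSlowlyVarying.eventually_rpow_bounds {L : ℝ → ℝ} (hL : IsSlowlyVarying L) {η : ℝ}
    (hη : 0 < η) : ∀ᶠ x in atTop, x ^ (-η) ≤ L x ∧ L x ≤ x ^ η := by
  -- In logarithmic coordinates slow variation is additive, and sublinear growth becomes the two
  -- power bounds.
  have hf : Measurable fun x => Real.log (L (Real.exp x)) :=
    Real.measurable_log.comp (hL.measurable.comp Real.measurable_exp)
  have hpos : ∀ᶠ x in atTop, 0 < L (Real.exp x) :=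
    Real.tendsto_exp_atTop.eventually hL.eventually_pos
  have h : ∀ u, Tendsto (fun x => Real.log (L (Real.exp (x + u))) - Real.log (L (Real.exp x)))
      atTop (𝓝 0) := by
    intro u
    have h1 := (hL.tendsto_ratio (Real.exp u) (Real.exp_pos u)).comp Real.tendsto_exp_atTop
    have h2 := h1.log one_ne_zero
    rw [Real.log_one] at h2
    refine h2.congr' ?_
    filter_upwards [hpos, (tendsto_atTop_add_const_right atTop u tendsto_id).eventually hpos]
      with x hx1 hx2
    simp only [Function.comp, id] at hx2 ⊢
    rw [← Real.exp_add, add_comm u x, Real.log_div hx2.ne' hx1.ne']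
  have h3 := Real.tendsto_log_atTop.eventually (eventually_abs_le_mul_of_tendsto_add_sub hf h hη)
  filter_upwards [h3, hL.eventually_pos, eventually_gt_atTop 0] with x hx hLx hx0
  rw [Real.exp_log hx0, abs_le] at hx
  rw [Real.rpow_def_of_pos hx0, Real.rpow_def_of_pos hx0]
  constructor
  · rw [← Real.le_log_iff_exp_le hLx]; linarith
  · rw [← Real.log_le_iff_le_exp hLx]; linarith

end SlowVariation

/-! ### Comparison of the stable and Gaussian scales. -/

section Rates

variable {α δ : ℝ} {L : ℝ → ℝ} {n : ℕ → ℕ}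

lemma tendsto_stable_scale_div_gaussian_scale (hα : α ∈ Set.Ioo (1 : ℝ) 2)
    (hL : IsSlowlyVarying L) (hn : Tendsto n atTop atTop) (hδ : 0 < δ)
    (h : ∀ᶠ d : ℕ in atTop, (d : ℝ) ^ (α / (2 * α - 2) + δ) < (n d : ℝ)) :
    Tendsto (fun d : ℕ => ((n d : ℝ) ^ (1 / α) * L (n d)) / √(2 * (n d : ℝ) ^ 2 / d)) atTop
      (𝓝 0) := by
  obtain ⟨h1, h2⟩ := hα
  have hp : 0 < α / (2 * α - 2) := div_pos (by linarith) (by linarith)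
  set p := α / (2 * α - 2) with hp_def
  have hpq : 1 / (2 * p) = 1 - 1 / α := by
    rw [hp_def]; have : 2 * α - 2 ≠ 0 := by linarith
    field_simp
  set q := 1 / (2 * (p + δ)) with hq
  have hq' : q < 1 - 1 / α := by
    rw [← hpq]; exact one_div_lt_one_div_of_lt (by positivity) (by linarith)
  -- Half of the exponent gap pays for `L`, the other half is the rate of decay.
  set η := (1 - 1 / α - q) / 2 with hη
  have hη0 : 0 < η := by rw [hη]; linarith
  have hn' : Tendsto (fun d => (n d : ℝ)) atTop atTop := tendsto_natCast_atTop_atTop.comp hn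
  have hlim : Tendsto (fun d => (n d : ℝ) ^ (-η)) atTop (𝓝 0) :=
    (tendsto_rpow_neg_atTop hη0).comp hn'
  refine squeeze_zero' ?_ ?_ hlim
  · filter_upwards [hn'.eventually hL.eventually_pos] with d hd
    positivity
  · filter_upwards [hn'.eventually (hL.eventually_rpow_bounds hη0), h, hn'.eventually_gt_atTop 0,
      eventually_gt_atTop 0] with d ⟨_, hLd⟩ hd hn0 hd0
    have hd0' : (0 : ℝ) < d := by exact_mod_cast hd0
    have hdn : (d : ℝ) ≤ (n d : ℝ) ^ (2 * q) := by
      have h3 := Real.rpow_le_rpow (by positivity) hd.le (by positivity : 0 ≤ 2 * q)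
      rw [← Real.rpow_mul hd0'.le] at h3
      rwa [show (p + δ) * (2 * q) = 1 by rw [hq]; field_simp, Real.rpow_one] at h3
    have hs : (n d : ℝ) ^ (1 - q) ≤ √(2 * (n d : ℝ) ^ 2 / d) := by
      refine Real.le_sqrt_of_sq_le ?_
      rw [← Real.rpow_natCast, ← Real.rpow_mul hn0.le, le_div_iff₀ hd0']
      calc _ ≤ (n d : ℝ) ^ ((1 - q) * (2 : ℕ)) * (n d : ℝ) ^ (2 * q) := by gcongr
        _ = (n d : ℝ) ^ 2 := by
          rw [← Real.rpow_add hn0, show (1 - q) * (2 : ℕ) + 2 * q = (2 : ℕ) by push_cast; ring,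
            Real.rpow_natCast]
        _ ≤ 2 * (n d : ℝ) ^ 2 := by nlinarith [sq_nonneg (n d : ℝ)]
    rw [div_le_iff₀ (by positivity)]
    calc (n d : ℝ) ^ (1 / α) * L (n d) ≤ (n d : ℝ) ^ (1 / α) * (n d : ℝ) ^ η := by gcongr
      _ = (n d : ℝ) ^ (-η) * (n d : ℝ) ^ (1 - q) := by
        rw [← Real.rpow_add hn0, ← Real.rpow_add hn0]
        congr 1; rw [hη]; ring
      _ ≤ _ := by gcongr

lemma tendsto_gaussian_scale_sq_div_stable_scale_sq (hα : α ∈ Set.Ioo (1 : ℝ) 2)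
    (hL : IsSlowlyVarying L) (hn : Tendsto n atTop atTop) (hδ : 0 < δ)
    (h : ∀ᶠ d : ℕ in atTop, (n d : ℝ) < (d : ℝ) ^ (α / (2 * α - 2) - δ)) :
    Tendsto (fun d : ℕ => (n d : ℝ) ^ 2 / (d * ((n d : ℝ) ^ (1 / α) * L (n d)) ^ 2)) atTop
      (𝓝 0) := by
  obtain ⟨h1, h2⟩ := hα
  have hp : 0 < α / (2 * α - 2) := div_pos (by linarith) (by linarith)
  set p := α / (2 * α - 2) with hp_def
  have hpq : 1 / p = 2 - 2 / α := by
    rw [hp_def]; have : 2 * α - 2 ≠ 0 := by linarith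
    field_simp
  have hn' : Tendsto (fun d => (n d : ℝ)) atTop atTop := tendsto_natCast_atTop_atTop.comp hn
  -- Otherwise `n d < 1` for large `d`, against `n d → ∞`.
  have hδp : δ < p := by
    by_contra! hcon
    obtain ⟨d, hd1, hd2, hd3⟩ := (h.and ((hn'.eventually_ge_atTop 1).and
      (eventually_gt_atTop 0))).exists
    have hd0 : (1 : ℝ) ≤ d := by exact_mod_cast hd3
    have := Real.rpow_le_one_of_one_le_of_nonpos hd0 (by linarith : p - δ ≤ 0)
    linarith
  set q := 1 / (p - δ) with hq
  have hpδ : 0 < p - δ := by linarith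
  have hq' : 2 - 2 / α < q := by
    rw [← hpq]; exact one_div_lt_one_div_of_lt hpδ (by linarith)
  have hq0 : 0 < q := by positivity
  -- `L` enters squared, so two thirds of the gap pay for it and one third is the rate of decay.
  set η := (q - (2 - 2 / α)) / 3 with hη
  have hη0 : 0 < η := by rw [hη]; linarith
  have hlim : Tendsto (fun d => (n d : ℝ) ^ (-η)) atTop (𝓝 0) :=
    (tendsto_rpow_neg_atTop hη0).comp hn'
  refine squeeze_zero' (Eventually.of_forall fun d => by positivity) ?_ hlim
  filter_upwards [hn'.eventually (hL.eventually_rpow_bounds hη0), h, hn'.eventually_gt_atTop 0,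
      eventually_gt_atTop 0] with d ⟨hLd, _⟩ hd hn0 hd0
  have hd0' : (0 : ℝ) < d := by exact_mod_cast hd0
  have hLpos : 0 < L (n d) := (Real.rpow_pos_of_pos hn0 _).trans_le hLd
  have hdn : (n d : ℝ) ^ q ≤ d := by
    have h3 := Real.rpow_le_rpow hn0.le hd.le hq0.le
    rw [← Real.rpow_mul hd0'.le] at h3
    rwa [show (p - δ) * q = 1 by rw [hq]; field_simp, Real.rpow_one] at h3
  rw [div_le_iff₀ (by positivity)]
  calc (n d : ℝ) ^ 2 = (n d : ℝ) ^ (-η) * ((n d : ℝ) ^ q *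
        ((n d : ℝ) ^ (1 / α) * (n d : ℝ) ^ (-η)) ^ 2) := by
        rw [← Real.rpow_add hn0, ← Real.rpow_natCast (_ ^ _) 2, ← Real.rpow_mul hn0.le,
          ← Real.rpow_add hn0, ← Real.rpow_add hn0, ← Real.rpow_natCast]
        congr 1; push_cast; rw [hη]; ring
    _ ≤ _ := by gcongr

end Rates

/-! ### Limits of the off-diagonal part. -/

section Limits

variable {Ω : Type*} [MeasurableSpace Ω] {P : Measure Ω}
  {R : ℕ → Ω → ℝ} {U : (d : ℕ) → ℕ → Ω → EuclideanSpace ℝ (Fin d)} {n : ℕ → ℕ}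

namespace IsRotationInvariantModel

lemma measurable_offDiag (hM : IsRotationInvariantModel P R U) (d m : ℕ) :
    Measurable fun ω => offDiag (fun i : Fin m => R i ω) (fun i => U d i ω) := by
  -- The model assumes nothing about the directions for `d = 0`, but convergence in distribution
  -- asks for measurability at every index.
  rcases Nat.eq_zero_or_pos d with rfl | hd
  · have : (fun ω => offDiag (fun i : Fin m => R i ω) (fun i => U 0 i ω)) = fun _ => 0 := by
      ext ω
      have : ∀ x y : EuclideanSpace ℝ (Fin 0), ⟪x, y⟫ = 0 := fun x y => by
        rw [Subsingleton.elim x 0, inner_zero_left]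
      simp [offDiag, this]
    rw [this]; exact measurable_const
  · have hR : Measurable fun ω (i : Fin m) => R i ω :=
      measurable_pi_lambda _ fun i => hM.measurable_radial i
    have hU : Measurable fun ω (i : Fin m) => U d i ω :=
      measurable_pi_lambda _ fun i => hM.measurable_direction d hd i
    exact _root_.measurable_offDiag.comp (hR.prodMk hU)

lemma measurable_walk (hM : IsRotationInvariantModel P R U) (d m : ℕ) :
    Measurable (walk R U d m) := by
  rcases Nat.eq_zero_or_pos d with rfl | hd
  · exact measurable_of_subsingleton_codomain _
  · have hR := hM.measurable_radial
    have hU := hM.measurable_direction d hd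
    unfold walk
    fun_prop

/-- The squared norm of the walk splits into its diagonal and off-diagonal parts. -/
lemma ae_norm_walk_sq (hM : IsRotationInvariantModel P R U) {d : ℕ} (hd : 0 < d) (m : ℕ) :
    ∀ᵐ ω ∂P, ‖walk R U d m ω‖ ^ 2 = ∑ i ∈ Finset.range m, R i ω ^ 2 +
      offDiag (fun i : Fin m => R i ω) (fun i => U d i ω) := by
  have h1 : ∀ i, ∀ᵐ ω ∂P, ‖U d i ω‖ = 1 := fun i => by
    have h := ae_norm_eq_one_uniformUnitSphere (d := d)
    rw [← hM.direction_uniform d hd i] at h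
    exact ae_of_ae_map (hM.measurable_direction d hd i).aemeasurable h
  filter_upwards [ae_all_iff.2 h1] with ω hω
  rw [walk, ← Fin.sum_univ_eq_sum_range (fun i => R i ω • U d i ω) m, norm_sq_sum_smul_eq,
    ← Fin.sum_univ_eq_sum_range (fun i => R i ω ^ 2) m, offDiag]
  simp [hω]

variable [IsProbabilityMeasure P]

lemma tendsto_integral_cexp_offDiag_gaussian (hM : IsRotationInvariantModel P R U)
    (hn : Tendsto n atTop atTop) (t : ℝ) :
    Tendsto (fun d => ∫ ω, Complex.exp (Complex.I * (t * (offDiag (fun i : Fin (n d) => R i ω)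
      (fun i => U d i ω) / √(2 * (n d : ℝ) ^ 2 / d)) : ℝ)) ∂P) atTop
      (𝓝 (Complex.exp (-t ^ 2 / 2))) := by
  refine hM.tendsto_integral_cexp_offDiag n _ t ?_
  filter_upwards [hM.ae_tendsto_sum_sq_div] with ω hω
  have hω4 := tendsto_sum_sq_div_sq_of_tendsto_sum_div (fun i => sq_nonneg (R i ω)) hω
  have h1 := hω.comp hn
  have h2 := hω4.comp hn
  have hlim : Tendsto (fun d : ℕ =>
      |t| * √(4 * ((∑ i ∈ Finset.range (n d), R i ω ^ 2) / n d) ^ 2 / d) +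
      |t| * √((∑ i ∈ Finset.range (n d), (R i ω ^ 2) ^ 2) / (n d : ℝ) ^ 2) +
      |t| * √(((∑ i ∈ Finset.range (n d), R i ω ^ 2) / n d - 1) ^ 2)) atTop (𝓝 0) := by
    have l1 : Tendsto (fun d : ℕ => 4 * ((∑ i ∈ Finset.range (n d), R i ω ^ 2) / n d) ^ 2 / d)
        atTop (𝓝 0) := ((h1.pow 2).const_mul 4).div_atTop tendsto_natCast_atTop_atTop
    have l3 : Tendsto (fun d : ℕ => ((∑ i ∈ Finset.range (n d), R i ω ^ 2) / n d - 1) ^ 2)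
        atTop (𝓝 ((1 - 1) ^ 2)) := (h1.sub_const 1).pow 2
    have := ((l1.sqrt.const_mul |t|).add (h2.sqrt.const_mul |t|)).add (l3.sqrt.const_mul |t|)
    simpa using this
  have hz := tendsto_integral_cexp_norm_sq_stdGaussian t
  rw [tendsto_iff_norm_sub_tendsto_zero] at hz ⊢
  have hsum := hlim.add hz
  rw [add_zero] at hsum
  refine squeeze_zero' (Eventually.of_forall fun d => norm_nonneg _) ?_ hsum
  filter_upwards [eventually_gt_atTop 0, hn.eventually_gt_atTop 0] with d hd hnd
  have hb := norm_integral_cexp_offDiag_sub_le hd hnd (fun i : Fin (n d) => R i ω) t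
  rw [Fin.sum_univ_eq_sum_range (fun i => R i ω ^ 2) (n d),
    Fin.sum_univ_eq_sum_range (fun i => R i ω ^ 4) (n d)] at hb
  simp_rw [← pow_mul]
  exact (norm_sub_le_norm_sub_add_norm_sub _ _ _).trans (by gcongr)

lemma tendsto_integral_cexp_offDiag_one (hM : IsRotationInvariantModel P R U)
    (hn : Tendsto n atTop atTop) {a : ℕ → ℝ}
    (ha : Tendsto (fun d : ℕ => (n d : ℝ) ^ 2 / (d * a d ^ 2)) atTop (𝓝 0)) (t : ℝ) :
    Tendsto (fun d => ∫ ω, Complex.exp (Complex.I * (t * (offDiag (fun i : Fin (n d) => R i ω)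
      (fun i => U d i ω) / a d) : ℝ)) ∂P) atTop (𝓝 1) := by
  refine hM.tendsto_integral_cexp_offDiag n _ t ?_
  filter_upwards [hM.ae_tendsto_sum_sq_div] with ω hω
  have h1 := hω.comp hn
  have hlim : Tendsto (fun d : ℕ => |t| * √(2 * ((∑ i ∈ Finset.range (n d), R i ω ^ 2) / n d) ^ 2 *
      ((n d : ℝ) ^ 2 / (d * a d ^ 2)))) atTop (𝓝 0) := by
    -- The averages of `R_i²` converge, so the conditional variance is of order `n² / (d a²)`.
    have := ((((h1.pow 2).const_mul 2).mul ha).sqrt).const_mul |t|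
    simpa using this
  rw [tendsto_iff_norm_sub_tendsto_zero]
  refine squeeze_zero' (Eventually.of_forall fun d => norm_nonneg _) ?_ hlim
  filter_upwards [eventually_gt_atTop 0, hn.eventually_gt_atTop 0] with d hd hnd
  have hb := norm_integral_cexp_offDiag_sub_one_le hd (fun i : Fin (n d) => R i ω) (a d) t
  rw [Fin.sum_univ_eq_sum_range (fun i => R i ω ^ 2) (n d)] at hb
  refine hb.trans_eq ?_
  have : (n d : ℝ) ≠ 0 := by positivity
  congr 2
  field_simp

end IsRotationInvariantModel

end Limits

/-! ### Assembly of the two regimes. -/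

theorem mainTheorem10
    {Ω Ω' : Type*} [MeasurableSpace Ω] [MeasurableSpace Ω']
    (P : Measure Ω) [IsProbabilityMeasure P] (P' : Measure Ω') [IsProbabilityMeasure P']
    (R : ℕ → Ω → ℝ) (U : (d : ℕ) → ℕ → Ω → EuclideanSpace ℝ (Fin d))
    (hmodel : IsRotationInvariantModel P R U)
    (α : ℝ) (hα : α ∈ Set.Ioo (1 : ℝ) 2)
    (L : ℝ → ℝ) (hL : IsSlowlyVarying L)
    (ζ : Ω' → ℝ) (hζ : Measurable ζ) (hζ_stable : IsSpectrallyPositiveStable α (P'.map ζ))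
    (hζ_int : Integrable ζ P') (hζ_mean : ∫ ω, ζ ω ∂P' = 0)
    (hattr : TendstoInDistribution
      (fun (m : ℕ) ω => (∑ i ∈ Finset.range m, (R i ω) ^ 2 - (m : ℝ)) /
        ((m : ℝ) ^ (1 / α) * L m))
      atTop ζ (fun _ => P) P')
    (n : ℕ → ℕ) (hn : Tendsto n atTop atTop) :
    ((∃ δ : ℝ, 0 < δ ∧
        ∀ᶠ d : ℕ in atTop, (d : ℝ) ^ (α / (2 * α - 2) + δ) < (n d : ℝ)) →
      TendstoInDistribution
        (fun (d : ℕ) ω => (‖walk R U d (n d) ω‖ ^ 2 - (n d : ℝ)) /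
          Real.sqrt (2 * (n d : ℝ) ^ 2 / (d : ℝ)))
        atTop (id : ℝ → ℝ) (fun _ => P) (gaussianReal 0 1)) ∧
    ((∃ δ : ℝ, 0 < δ ∧
        ∀ᶠ d : ℕ in atTop, (n d : ℝ) < (d : ℝ) ^ (α / (2 * α - 2) - δ)) →
      TendstoInDistribution
        (fun (d : ℕ) ω => (‖walk R U d (n d) ω‖ ^ 2 - (n d : ℝ)) /
          ((n d : ℝ) ^ (1 / α) * L (n d)))
        atTop ζ (fun _ => P) P') := by
  have hsplit : ∀ b : ℕ → ℝ, ∀ᶠ d in atTop,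
      (fun ω => (‖walk R U d (n d) ω‖ ^ 2 - (n d : ℝ)) / b d) =ᵐ[P]
      fun ω => (∑ i ∈ Finset.range (n d), (R i ω) ^ 2 - (n d : ℝ)) / b d +
        offDiag (fun i : Fin (n d) => R i ω) (fun i => U d i ω) / b d := by
    intro b
    filter_upwards [eventually_gt_atTop 0] with d hd
    filter_upwards [hmodel.ae_norm_walk_sq hd (n d)] with ω hω
    rw [hω]; ring
  have hmeas : ∀ b : ℕ → ℝ, ∀ d, Measurable
      fun ω => (‖walk R U d (n d) ω‖ ^ 2 - (n d : ℝ)) / b d := by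
    intro b d
    have := hmodel.measurable_walk d (n d)
    fun_prop
  have hdiag : TendstoInDistribution
      (fun (d : ℕ) ω => (∑ i ∈ Finset.range (n d), (R i ω) ^ 2 - (n d : ℝ)) /
        ((n d : ℝ) ^ (1 / α) * L (n d))) atTop ζ (fun _ => P) P' :=
    ⟨fun d => hattr.forall_aemeasurable (n d), hattr.aemeasurable_limit, hattr.tendsto.comp hn⟩
  constructor
  · rintro ⟨δ, hδ, h⟩
    set b : ℕ → ℝ := fun d => √(2 * (n d : ℝ) ^ 2 / d)
    have hX : TendstoInDistribution
        (fun (d : ℕ) ω => offDiag (fun i : Fin (n d) => R i ω) (fun i => U d i ω) / b d)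
        atTop (id : ℝ → ℝ) (fun _ => P) (gaussianReal 0 1) := by
      refine tendstoInDistribution_of_tendsto_integral_cexp
        (fun d => (hmodel.measurable_offDiag d (n d)).div_const _) measurable_id fun t => ?_
      rw [Measure.map_id, charFun_gaussianReal]
      convert hmodel.tendsto_integral_cexp_offDiag_gaussian hn t using 3
      simp [neg_div]
    have hc := tendsto_stable_scale_div_gaussian_scale hα hL hn hδ h
    -- The diagonal part on the Gaussian scale is a convergent variable times a ratio of scales
    -- tending to `0`, so it vanishes in probability.
    have hprod := hdiag.continuous_comp_prodMk_of_tendstoInMeasure_const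
      (g := fun z : ℝ × ℝ => z.1 * z.2) (by fun_prop) (c := (0 : ℝ))
      (Y := fun d _ => ((n d : ℝ) ^ (1 / α) * L (n d)) / b d)
      (tendstoInMeasure_of_tendsto_ae (fun d => aestronglyMeasurable_const)
        (ae_of_all _ fun _ => hc)) (fun d => aemeasurable_const)
    have h0 := tendstoInMeasure_of_tendstoInDistribution_zero (by simp) hprod
    refine tendstoInDistribution_of_tendstoInMeasure_sub _ _ hX ?_ fun d => (hmeas b d).aemeasurable
    refine h0.congr' ?_ (ae_eq_refl _)
    have hn' : Tendsto (fun d => (n d : ℝ)) atTop atTop := tendsto_natCast_atTop_atTop.comp hn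
    filter_upwards [hsplit b, hn'.eventually hL.eventually_pos, hn'.eventually_gt_atTop 0]
      with d hd hLd hnd
    filter_upwards [hd] with ω hω
    have : (n d : ℝ) ^ (1 / α) * L (n d) ≠ 0 := by positivity
    simp only [Pi.sub_apply]
    rw [hω, add_sub_cancel_right]
    field_simp
  · rintro ⟨δ, hδ, h⟩
    set b : ℕ → ℝ := fun d => (n d : ℝ) ^ (1 / α) * L (n d)
    have hQ : TendstoInDistribution
        (fun (d : ℕ) ω => offDiag (fun i : Fin (n d) => R i ω) (fun i => U d i ω) / b d)
        atTop (fun _ : Ω' => (0 : ℝ)) (fun _ => P) P' := by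
      refine tendstoInDistribution_of_tendsto_integral_cexp
        (fun d => (hmodel.measurable_offDiag d (n d)).div_const _) measurable_const fun t => ?_
      convert hmodel.tendsto_integral_cexp_offDiag_one hn
        (tendsto_gaussian_scale_sq_div_stable_scale_sq hα hL hn hδ h) t using 2
      simp
    have h0 := tendstoInMeasure_of_tendstoInDistribution_zero (by simp) hQ
    -- Here the roles are exchanged: the diagonal part carries the limit and the off-diagonal part
    -- is the negligible difference.
    refine tendstoInDistribution_of_tendstoInMeasure_sub _ _ hdiag ?_
      fun d => (hmeas b d).aemeasurable
    refine h0.congr' ?_ (ae_eq_refl _)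
    filter_upwards [hsplit b] with d hd
    filter_upwards [hd] with ω hω
    simp only [Pi.sub_apply]
    rw [hω, add_sub_cancel_left]
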